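/- **Correspondence between droop control and virtual oscillator control (VOC).** *Setting.* Consider a microgrid with $N$ inverters on a resistive network with (Kron-reduced) real conductance matrix $G=(G_{j\ell})$ and current sources $\iota_j\cos(\omega t+\gamma_j)$ at the inverter terminals. If inverter $j$ has terminal voltage $v_j(t)=r_j\cos(\omega t+\theta_j)$, it injects the current $$i_j(t)=\sum_{\ell=1}^N G_{j\ell}\,r_\ell\cos(\omega t+\theta_\ell)+\iota_j\cos(\omega t+\gamma_j).$$ For amplitudes $r$ and phase offsets $\theta$ write $$\overline P_j(r,\theta)=\frac{\omega}{2\pi}\int_0^{2\pi/\omega} r_j\cos(\omega s+\theta_j)\,i_j(s)\,ds,\qquad \overline Q_j(r,\theta)=\frac{\omega}{2\pi}\int_0^{2\pi/\omega} r_j\sin(\omega s+\theta_j)\,i_j(s)\,ds$$ for the average active and reactive power over an AC cycle. Let $L,C>0$, $\omega=1/\sqrt{LC}$, $\varepsilon=\sqrt{L/C}$, $\alpha,\beta>0$, $g(v)=v-\beta v^3/3$, and let $\kappa_j\in\mathbb R$ be the current gains. In the *VOC microgrid* each inverter is a Van der Pol oscillator, in polar coordinates with $r_j>0$: $$\frac{dr_j}{dt}=\frac1C\bigl(\alpha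 g(r_j\cos(\omega t+\theta_j))-\kappa_j i_j(t)\bigr)\cos(\omega t+\theta_j),$$ $$\frac{d\theta_j}{dt}=-\frac{1}{r_jC}\bigl(\alpha g(r_j\cos(\omega t+\theta_j))-\kappa_j i_j(t)\bigr)\sin(\omega t+\theta_j).$$ In the *droop microgrid*, on the same network, $$\frac{d\overline\theta_j}{dt}=n_j\bigl(\overline Q_j(\overline r,\overline\theta)-\overline Q_j^*\bigr),\qquad \overline r_j-\overline r_j^*=m_j\bigl(\overline P_j^*-\overline P_j(\overline r,\overline\theta)\bigr).$$ *Theorem.* Let $\overline P_{j,\mathrm{eq}}$ satisfy $0<\kappa_j\overline P_{j,\mathrm{eq}}<\frac{\alpha}{2\beta}$ for all $j$. Then the averaged VOC amplitude dynamics $\frac{d\overline r_j}{dt}=\frac{\alpha}{2C}\bigl(\overline r_j-\frac\beta4\overline r_j^3\bigr)-\frac{\kappa_j}{C\overline r_j}\overline P_{j,\mathrm{eq}}$ have a positive equilibrium, for each $j$. Let $\overline r_{j,\mathrm{eq}}>0$ be any such equilibria. Then $\alpha(\overline r_{j,\mathrm{eq}}-\frac\beta2\overline r_{j,\mathrm{eq}}^3)\neq0$.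 Choose the droop coefficients and setpoints $$n_j=\frac{\kappa_j}{\overline r_{j,\mathrm{eq}}^2C},\quad \overline Q_j^*=0,\qquad m_j=-\kappa_j\Bigl(\alpha\bigl(\overline r_{j,\mathrm{eq}}-\tfrac\beta2\overline r_{j,\mathrm{eq}}^3\bigr)\Bigr)^{-1},\quad \overline P_j^*=\overline P_{j,\mathrm{eq}},\quad \overline r_j^*=\overline r_{j,\mathrm{eq}}.$$ Let $t^*>0$, $C_0>0$ and $K_0\ge0$. Then there exist $\varepsilon^*>0$ and $K\ge 0$, depending only on $G,\iota,\gamma,\alpha,\beta,\kappa,\overline P_{\mathrm{eq}},\overline r_{\mathrm{eq}},t^*,C_0,K_0$, such that the following holds for all $L>0$ and $C\ge C_0$ with $\varepsilon=\sqrt{L/C}<\varepsilon^*$. Let $(\overline r,\overline\theta)$ be a solution of the droop microgrid on $[0,t^*]$ whose amplitudes are in steady state (constant in time), and let $(r_0,\theta_0)$ be initial data for the VOC microgrid that are in steady state up to order $\varepsilon$, $|r_{0,j}-\overline r_{j,\mathrm{eq}}|\le K_0\varepsilon$, and have initial differences of order $\varepsilon$, $|\overline r_j(0)-r_{0,j}|\le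 K_0\varepsilon$ and $|\overline\theta_j(0)-\theta_{0,j}|\le K_0\varepsilon$, for all $j$. Then the VOC microgrid has a solution on $[0,t^*]$ with initial data $(r_0,\theta_0)$, and every such solution satisfies, for all $t\in[0,t^*]$ and all $j$, $$|\overline r_j(t)-r_j(t)|\le K\varepsilon,\qquad |\overline\theta_j(t)-\theta_j(t)|\le K\varepsilon.$$ -/

import Mathlib

noncomputable section

namespace DroopVOC

/-- A microgrid of `N` identical Van der Pol inverters (or droop-controlled inverters) on a
resistive network whose internal nodes have been eliminated.  `α`, `β` are the oscillator
parameters (common to all inverters) and `κ j` the current gain of inverter `j`.  The network and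
its loads are given by the (reduced) conductance matrix `G`, together with one current source
`ι j * cos (ω t + γ j)` per inverter terminal. -/
structure Microgrid (N : ℕ) where
  α : ℝ
  β : ℝ
  κ : Fin N → ℝ
  G : Matrix (Fin N) (Fin N) ℝ
  ι : Fin N → ℝ
  γ : Fin N → ℝ

/-- The small parameter `ε = √(L / C)`. -/
def eps (L C : ℝ) : ℝ := √(L / C)

/-- The nominal frequency `ω = 1 / √(L C)`. -/
def freq (L C : ℝ) : ℝ := 1 / √(L * C)

variable {N : ℕ}

namespace Microgrid

/-- The characteristic `g(v) = v - β v³ / 3` of the nonlinear current source. -/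
def g (M : Microgrid N) (v : ℝ) : ℝ := v - M.β * (v ^ 3 / 3)

/-- The current injected by inverter `j` at time `t` (Ohm's and Kirchhoff's laws) when the terminal
voltages are `v_l = r_l cos (ω t + θ_l)`. -/
def current (M : Microgrid N) (ω : ℝ) (r θ : Fin N → ℝ) (t : ℝ) (j : Fin N) : ℝ :=
  ∑ l, M.G j l * (r l * Real.cos (ω * t + θ l)) + M.ι j * Real.cos (ω * t + M.γ j)

/-- Average active power of inverter `j` over one AC cycle, for sinusoidal terminal voltages of
amplitudes `r` and phase offsets `θ`. -/
def avgP (M : Microgrid N) (ω : ℝ) (r θ : Fin N → ℝ) (j : Fin N) : ℝ :=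
  ω / (2 * Real.pi) *
    ∫ s in (0 : ℝ)..(2 * Real.pi / ω), r j * Real.cos (ω * s + θ j) * M.current ω r θ s j

/-- Average reactive power of inverter `j` over one AC cycle, for sinusoidal terminal voltages of
amplitudes `r` and phase offsets `θ`. -/
def avgQ (M : Microgrid N) (ω : ℝ) (r θ : Fin N → ℝ) (j : Fin N) : ℝ :=
  ω / (2 * Real.pi) *
    ∫ s in (0 : ℝ)..(2 * Real.pi / ω), r j * Real.sin (ω * s + θ j) * M.current ω r θ s j

/-- Right-hand side of the amplitude equation of the cycle-averaged oscillator `j` that delivers the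
average active power `P` at amplitude `r`. -/
def avgAmplitudeRate (M : Microgrid N) (C : ℝ) (j : Fin N) (r P : ℝ) : ℝ :=
  M.α / (2 * C) * (r - M.β / 4 * r ^ 3) - M.κ j / (C * r) * P

/-- `r` is a (positive) amplitude equilibrium of the averaged oscillator `j` at the average active
power `P`.  The capacitance enters the averaged rate only through the factor `1 / C`. -/
def IsAmplitudeEquilibrium (M : Microgrid N) (j : Fin N) (P r : ℝ) : Prop :=
  0 < r ∧ ∀ C : ℝ, 0 < C → M.avgAmplitudeRate C j r P = 0

/-- `(r, θ)` solves, on `[0, T]`, the (non-averaged) polar dynamics of the network of Van der Pol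
inverters with inductance `L` and capacitance `C`; the current fed to the oscillator is minus
the current injected into the network. -/
structure IsVOCSolution (M : Microgrid N) (L C T : ℝ) (r θ : ℝ → Fin N → ℝ) : Prop where
  amplitude_pos : ∀ t ∈ Set.Icc 0 T, ∀ j, 0 < r t j
  amplitude_eq : ∀ t ∈ Set.Icc 0 T, ∀ j,
    HasDerivWithinAt (fun s => r s j)
      (1 / C * (M.α * M.g (r t j * Real.cos (freq L C * t + θ t j))
          + M.κ j * (-M.current (freq L C) (r t) (θ t) t j))
        * Real.cos (freq L C * t + θ t j))
      (Set.Icc 0 T) t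
  phase_eq : ∀ t ∈ Set.Icc 0 T, ∀ j,
    HasDerivWithinAt (fun s => θ s j)
      (-(M.α / (r t j * C) * M.g (r t j * Real.cos (freq L C * t + θ t j))
          + M.κ j * (-M.current (freq L C) (r t) (θ t) t j) / (r t j * C))
        * Real.sin (freq L C * t + θ t j))
      (Set.Icc 0 T) t

/-- `(r, θ)` solves, on `[0, T]`, the droop-control laws with frequency-droop coefficients `n`,
voltage-droop coefficients `m` and setpoints `Qs`, `Ps`, `rs`, on the same network, with nominal
frequency `ω`. -/
structure IsDroopSolution (M : Microgrid N) (ω : ℝ) (n m Qs Ps rs : Fin N → ℝ) (T : ℝ)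
    (r θ : ℝ → Fin N → ℝ) : Prop where
  phase_eq : ∀ t ∈ Set.Icc 0 T, ∀ j,
    HasDerivWithinAt (fun s => θ s j) (n j * (M.avgQ ω (r t) (θ t) j - Qs j)) (Set.Icc 0 T) t
  amplitude_eq : ∀ t ∈ Set.Icc 0 T, ∀ j,
    r t j - rs j = m j * (Ps j - M.avgP ω (r t) (θ t) j)

/-- The frequency-droop coefficients `n_j = κ_j / (r_eq² C)`. -/
def freqDroop (M : Microgrid N) (C : ℝ) (req : Fin N → ℝ) (j : Fin N) : ℝ :=
  M.κ j / (req j ^ 2 * C)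

/-- The voltage-droop coefficients `m_j = -κ_j (α (r_eq - β r_eq³ / 2))⁻¹`. -/
def voltDroop (M : Microgrid N) (req : Fin N → ℝ) (j : Fin N) : ℝ :=
  -M.κ j * (M.α * (req j - M.β / 2 * req j ^ 3))⁻¹

end Microgrid

end DroopVOC

end

/-!
The oscillator equations have the form `x' = (1 / C) F (ω t, x)` with `F` a trigonometric
polynomial in the phase `ω t`, and `1 / ω = ε C`. The cycle average of `F` is
`α / 2 * (r - β r³ / 4) - κ P / r` in the amplitudes and `κ Q / r²` in the phases
(`isOsc_field_fst`, `isOsc_field_snd`). A droop solution with constant amplitudes `ρ = r_eq + O(ε)`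
solves these averaged equations up to `O(ε)`. Its frequency droop is `κ Q / (r_eq² C)`
(`abs_phaseRate_sub_le`), and its voltage droop linearizes the balance
`κ P = α / 2 * (r² - β r⁴ / 4)` at `r_eq`, whose slope `α (r_eq - β r_eq³ / 2)` is nonzero
(`abs_amplitudeRate_le`).

So along the droop solution `y` the defect `F (ω t, y) - C y'` is, up to `O(ε)`, a sum of
harmonics of `2 ω t` and `4 ω t` with slowly varying phases. A primitive `w` of such a sum,
divided by `C`, is of size `1 / (ω C) = ε`; this is what `IsOsc` records. Hence `y + w` solves the
oscillator equations up to `O(ε)`, and Grönwall's inequality gives `|x - y| = O(ε)`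
(`dist_clamped_solution_le`). All rates carry the factor `1 / C ≤ 1 / C₀`, which makes the
constants uniform in `L` and `C`.

Since `F` is singular at zero amplitude and of cubic growth, the amplitudes are first clamped to
`[r_eq / 2, 2 r_eq]`; the clamped equation is globally Lipschitz and bounded, so it has a solution
on the whole interval. For small `ε` the estimate keeps this solution inside the box, where it
solves the original equations, and by uniqueness (`IsVOCSolution.eqOn`) it is the only solution
with its initial data.
-/

noncomputable section

namespace DroopVOC

variable {N : ℕ}

/-! ### Equilibria of the averaged amplitude dynamics -/

namespace Microgrid

/-- An amplitude equilibrium is a positive zero of a biquadratic polynomial in the amplitude. -/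
lemma isAmplitudeEquilibrium_iff (M : Microgrid N) (j : Fin N) (P r : ℝ) :
    M.IsAmplitudeEquilibrium j P r ↔
      0 < r ∧ M.α / 2 * (r ^ 2 - M.β / 4 * r ^ 4) = M.κ j * P := by
  unfold IsAmplitudeEquilibrium avgAmplitudeRate
  refine and_congr_right fun hr => ⟨fun h => ?_, fun h C hC => ?_⟩
  · have := h 1 one_pos
    field_simp at this
    linarith
  · have e : M.κ j / (C * r) * P = (M.κ j * P) / (C * r) := by ring
    rw [e, ← h]
    field_simp
    ring

lemma exists_isAmplitudeEquilibrium (M : Microgrid N) (hα : 0 < M.α) (hβ : 0 < M.β) {j : Fin N}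
    {P : ℝ} (h : M.κ j * P < M.α / (2 * M.β)) :
    ∃ ρ, M.IsAmplitudeEquilibrium j P ρ := by
  -- the larger root of the quadratic equation in `ρ ^ 2`
  set q := √(1 - 2 * M.β * (M.κ j * P) / M.α) with hq
  have hq2 : q ^ 2 = 1 - 2 * M.β * (M.κ j * P) / M.α := by
    refine Real.sq_sqrt ?_
    rw [lt_div_iff₀ (by positivity)] at h
    rw [sub_nonneg, div_le_one hα]
    linarith
  have hq0 : 0 ≤ q := Real.sqrt_nonneg _
  have hs : 0 < 2 / M.β * (1 + q) := by positivity
  refine ⟨√(2 / M.β * (1 + q)), (M.isAmplitudeEquilibrium_iff j P _).2 ⟨Real.sqrt_pos.2 hs, ?_⟩⟩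
  have h4 : √(2 / M.β * (1 + q)) ^ 4 = (2 / M.β * (1 + q)) ^ 2 := by
    rw [show (4 : ℕ) = 2 * 2 from rfl, pow_mul, Real.sq_sqrt hs.le]
  rw [h4, Real.sq_sqrt hs.le]
  field_simp at hq2 ⊢
  linear_combination -2 * hq2

/-- The slope of the scaled power `α / 2 * (r² - β r⁴ / 4)` vanishes only where this power is
maximal, and there it equals `α / (2 β)`. -/
lemma IsAmplitudeEquilibrium.slope_ne_zero {M : Microgrid N} (hα : 0 < M.α) (hβ : 0 < M.β)
    {j : Fin N} {P r : ℝ} (hr : M.IsAmplitudeEquilibrium j P r)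
    (h : M.κ j * P < M.α / (2 * M.β)) : M.α * (r - M.β / 2 * r ^ 3) ≠ 0 := by
  obtain ⟨hr0, he⟩ := (M.isAmplitudeEquilibrium_iff j P r).1 hr
  intro h0
  have h1 : r ^ 2 = 2 / M.β := by
    have h2 : r * (1 - M.β / 2 * r ^ 2) = 0 := by
      have := (mul_eq_zero.1 h0).resolve_left hα.ne'
      linarith
    have := (mul_eq_zero.1 h2).resolve_left hr0.ne'
    field_simp
    linarith
  have h4 : r ^ 4 = (2 / M.β) ^ 2 := by rw [← h1]; ring
  rw [h1, h4] at he
  have : M.α / 2 * (2 / M.β - M.β / 4 * (2 / M.β) ^ 2) = M.α / (2 * M.β) := by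
    field_simp
    ring
  linarith

end Microgrid

/-! ### Bounded Lipschitz functions of the state -/

/-- `f φ` is bounded and Lipschitz on `S`, with constants that do not depend on `φ`. -/
def BddLip {X : Type*} [PseudoMetricSpace X] (S : Set X) (f : ℝ → X → ℝ) : Prop :=
  ∃ B, 0 ≤ B ∧ ∀ φ, ∀ x ∈ S, |f φ x| ≤ B ∧ ∀ y ∈ S, |f φ x - f φ y| ≤ B * dist x y

namespace BddLip

variable {X : Type*} [PseudoMetricSpace X] {S : Set X} {f g : ℝ → X → ℝ}

lemma const (c : ℝ) : BddLip S (fun _ _ => c) :=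
  ⟨|c|, abs_nonneg c, fun _ x _ => ⟨le_rfl, fun y _ => by simpa using by positivity⟩⟩

lemma add (hf : BddLip S f) (hg : BddLip S g) : BddLip S (fun φ x => f φ x + g φ x) := by
  obtain ⟨A, hA, hf⟩ := hf
  obtain ⟨B, hB, hg⟩ := hg
  refine ⟨A + B, by positivity, fun φ x hx =>
    ⟨(abs_add_le _ _).trans (add_le_add (hf φ x hx).1 (hg φ x hx).1), fun y hy => ?_⟩⟩
  have h1 := (hf φ x hx).2 y hy
  have h2 := (hg φ x hx).2 y hy
  calc |f φ x + g φ x - (f φ y + g φ y)| = |(f φ x - f φ y) + (g φ x - g φ y)| := by ring_nf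
    _ ≤ _ := abs_add_le _ _
    _ ≤ (A + B) * dist x y := by linarith

lemma mul (hf : BddLip S f) (hg : BddLip S g) : BddLip S (fun φ x => f φ x * g φ x) := by
  obtain ⟨A, hA, hf⟩ := hf
  obtain ⟨B, hB, hg⟩ := hg
  refine ⟨A * B + A * B, by positivity, fun φ x hx => ⟨?_, fun y hy => ?_⟩⟩
  · rw [abs_mul]
    have := mul_le_mul (hf φ x hx).1 (hg φ x hx).1 (abs_nonneg _) hA
    have : 0 ≤ A * B := by positivity
    linarith
  · calc |f φ x * g φ x - f φ y * g φ y|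
        = |f φ x * (g φ x - g φ y) + (f φ x - f φ y) * g φ y| := by ring_nf
      _ ≤ |f φ x * (g φ x - g φ y)| + |(f φ x - f φ y) * g φ y| := abs_add_le _ _
      _ ≤ A * (B * dist x y) + (A * dist x y) * B := by
          rw [abs_mul, abs_mul]
          exact add_le_add
            (mul_le_mul (hf φ x hx).1 ((hg φ x hx).2 y hy) (abs_nonneg _) hA)
            (mul_le_mul ((hf φ x hx).2 y hy) (hg φ y hy).1 (abs_nonneg _) (by positivity))
      _ = (A * B + A * B) * dist x y := by ring

lemma const_mul (c : ℝ) (hf : BddLip S f) : BddLip S (fun φ x => c * f φ x) :=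
  (const c).mul hf

lemma pow (hf : BddLip S f) (n : ℕ) : BddLip S (fun φ x => f φ x ^ n) := by
  induction n with
  | zero => simpa using const 1
  | succ n ih => simpa only [pow_succ] using ih.mul hf

lemma sum {ι : Type*} (s : Finset ι) {f : ι → ℝ → X → ℝ} (hf : ∀ i ∈ s, BddLip S (f i)) :
    BddLip S (fun φ x => ∑ i ∈ s, f i φ x) := by
  classical
  induction s using Finset.induction_on with
  | empty => simpa using const 0
  | insert i s hi ih =>
    simp only [Finset.sum_insert hi]
    exact (hf i (Finset.mem_insert_self i s)).add
      (ih fun k hk => hf k (Finset.mem_insert_of_mem hk))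

/-- Post-composition with a bounded Lipschitz function of one variable preserves `BddLip`, even
when the argument carries an unbounded `φ`-dependent shift. -/
lemma comp_shift {h : ℝ → ℝ} {u : X → ℝ} (hh : ∀ a, |h a| ≤ 1) (hl : ∀ a b, |h a - h b| ≤ |a - b|)
    (hu : ∀ x ∈ S, ∀ y ∈ S, |u x - u y| ≤ dist x y) : BddLip S (fun φ x => h (φ + u x)) :=
  ⟨1, zero_le_one, fun φ x hx => ⟨hh _, fun y hy => by
    simpa using (hl _ _).trans (by simpa using hu x hx y hy)⟩⟩

lemma inv {u : X → ℝ} {c : ℝ} (hc : 0 < c) (hu : ∀ x ∈ S, c ≤ u x)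
    (hl : ∀ x ∈ S, ∀ y ∈ S, |u x - u y| ≤ dist x y) : BddLip S (fun _ x => (u x)⁻¹) := by
  have hb : ∀ x ∈ S, 0 ≤ (u x)⁻¹ ∧ (u x)⁻¹ ≤ c⁻¹ := fun x hx =>
    ⟨inv_nonneg.2 (hc.le.trans (hu x hx)), inv_anti₀ hc (hu x hx)⟩
  refine ⟨c⁻¹ + c⁻¹ * c⁻¹, by positivity, fun _ x hx => ⟨?_, fun y hy => ?_⟩⟩
  · rw [abs_of_nonneg (hb x hx).1]
    have : 0 ≤ c⁻¹ * c⁻¹ := by positivity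
    linarith [(hb x hx).2]
  · have hx0 : u x ≠ 0 := (hc.trans_le (hu x hx)).ne'
    have hy0 : u y ≠ 0 := (hc.trans_le (hu y hy)).ne'
    have e : (u x)⁻¹ - (u y)⁻¹ = (u x)⁻¹ * (u y)⁻¹ * (u y - u x) := by field_simp
    rw [e, abs_mul, abs_of_nonneg (mul_nonneg (hb x hx).1 (hb y hy).1), abs_sub_comm]
    calc (u x)⁻¹ * (u y)⁻¹ * |u x - u y| ≤ c⁻¹ * c⁻¹ * dist x y :=
          mul_le_mul (mul_le_mul (hb x hx).2 (hb y hy).2 (hb y hy).1 (by positivity))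
            (hl x hx y hy) (abs_nonneg _) (by positivity)
      _ ≤ (c⁻¹ + c⁻¹ * c⁻¹) * dist x y :=
          mul_le_mul_of_nonneg_right (by linarith [inv_pos.2 hc]) dist_nonneg

end BddLip

lemma abs_cos_sub_cos_le (a b : ℝ) : |Real.cos a - Real.cos b| ≤ |a - b| := by
  have h := Real.lipschitzWith_cos.dist_le_mul a b
  simpa [Real.dist_eq] using h

lemma abs_sin_sub_sin_le (a b : ℝ) : |Real.sin a - Real.sin b| ≤ |a - b| := by
  have h := Real.lipschitzWith_sin.dist_le_mul a b
  simpa [Real.dist_eq] using h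

/-! ### The oscillator vector field -/

/-- A state of the microgrid: the amplitudes and the phase offsets, with the sup norm. -/
abbrev State (N : ℕ) := (Fin N → ℝ) × (Fin N → ℝ)

/-- The states with amplitudes between `lo` and `hi`. -/
def amplitudeBox (lo hi : Fin N → ℝ) : Set (State N) :=
  {x | ∀ j, x.1 j ∈ Set.Icc (lo j) (hi j)}

lemma abs_fst_sub_le (x y : State N) (j : Fin N) : |x.1 j - y.1 j| ≤ dist x y :=
  (dist_le_pi_dist x.1 y.1 j).trans (le_max_left _ _)

lemma abs_snd_sub_le (x y : State N) (j : Fin N) : |x.2 j - y.2 j| ≤ dist x y :=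
  (dist_le_pi_dist x.2 y.2 j).trans (le_max_right _ _)

lemma dist_le_of_coord {x y : State N} {d : ℝ} (hd : 0 ≤ d) (h1 : ∀ j, |x.1 j - y.1 j| ≤ d)
    (h2 : ∀ j, |x.2 j - y.2 j| ≤ d) : dist x y ≤ d :=
  max_le ((dist_pi_le_iff hd).2 h1) ((dist_pi_le_iff hd).2 h2)

namespace Microgrid

/-- The net current into the nonlinear oscillator `j` at the phase `φ = ω t`. -/
def drive (M : Microgrid N) (φ : ℝ) (x : State N) (j : Fin N) : ℝ :=
  M.α * M.g (x.1 j * Real.cos (φ + x.2 j)) - M.κ j * M.current 1 x.1 x.2 φ j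

/-- The vector field of the oscillator network as a function of the phase `φ = ω t`, without the
factor `1 / C`. -/
def field (M : Microgrid N) (φ : ℝ) (x : State N) : State N :=
  (fun j => M.drive φ x j * Real.cos (φ + x.2 j),
   fun j => -(M.drive φ x j * Real.sin (φ + x.2 j) * (x.1 j)⁻¹))

lemma current_eq (M : Microgrid N) (ω : ℝ) (r θ : Fin N → ℝ) (t : ℝ) (j : Fin N) :
    M.current ω r θ t j = M.current 1 r θ (ω * t) j := by
  simp [current]

lemma bddLip_fst (lo hi : Fin N → ℝ) (j : Fin N) :
    BddLip (amplitudeBox lo hi) (fun _ x => x.1 j) := by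
  refine ⟨1 + |lo j| + |hi j|, by positivity, fun _ x hx => ⟨?_, fun y _ => ?_⟩⟩
  · have := hx j
    rw [abs_le]
    constructor
    · linarith [neg_abs_le (lo j), this.1, abs_nonneg (hi j)]
    · linarith [le_abs_self (hi j), this.2, abs_nonneg (lo j)]
  · refine (abs_fst_sub_le x y j).trans (le_mul_of_one_le_left dist_nonneg ?_)
    linarith [abs_nonneg (hi j), abs_nonneg (lo j)]

lemma bddLip_drive (M : Microgrid N) (lo hi : Fin N → ℝ) (j : Fin N) :
    BddLip (amplitudeBox lo hi) (fun φ x => M.drive φ x j) := by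
  have hcos : ∀ l, BddLip (amplitudeBox lo hi) (fun φ x => Real.cos (φ + x.2 l)) := fun l =>
    BddLip.comp_shift Real.abs_cos_le_one abs_cos_sub_cos_le fun x _ y _ => abs_snd_sub_le x y l
  have hγ : BddLip (amplitudeBox lo hi) (fun φ _ => Real.cos (φ + M.γ j)) :=
    BddLip.comp_shift Real.abs_cos_le_one abs_cos_sub_cos_le fun x _ y _ => by simp
  have hv := (bddLip_fst lo hi j).mul (hcos j)
  have hg := (hv.add ((hv.pow 3).const_mul (-M.β / 3))).const_mul M.α
  have hi := (((BddLip.sum Finset.univ fun l _ =>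
    ((bddLip_fst lo hi l).mul (hcos l)).const_mul (M.G j l)).add (hγ.const_mul (M.ι j))).const_mul
      (-M.κ j))
  convert hg.add hi using 3
  simp only [drive, g, current, one_mul]
  ring

/-- On amplitudes bounded away from zero and infinity the oscillator field is bounded and
Lipschitz, uniformly in the phase. -/
lemma exists_field_bound (M : Microgrid N) {lo hi : Fin N → ℝ} (hlo : ∀ j, 0 < lo j) :
    ∃ Λ, 1 ≤ Λ ∧ ∀ φ, ∀ x ∈ amplitudeBox lo hi, ‖M.field φ x‖ ≤ Λ ∧
      ∀ y ∈ amplitudeBox lo hi, dist (M.field φ x) (M.field φ y) ≤ Λ * dist x y := by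
  have h1 : ∀ j, BddLip (amplitudeBox lo hi) (fun φ x => (M.field φ x).1 j) := fun j =>
    (M.bddLip_drive lo hi j).mul (BddLip.comp_shift Real.abs_cos_le_one abs_cos_sub_cos_le
      fun x _ y _ => abs_snd_sub_le x y j)
  have h2 : ∀ j, BddLip (amplitudeBox lo hi) (fun φ x => (M.field φ x).2 j) := fun j => by
    have := (((M.bddLip_drive lo hi j).mul (BddLip.comp_shift Real.abs_sin_le_one
      abs_sin_sub_sin_le fun x _ y _ => abs_snd_sub_le x y j)).mul
      (BddLip.inv (hlo j) (fun x hx => (hx j).1) fun x _ y _ => abs_fst_sub_le x y j)).const_mul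
      (-1)
    simpa only [field, neg_one_mul] using this
  choose A hA0 hA using h1
  choose B hB0 hB using h2
  set Λ := 1 + ∑ j, (A j + B j) with hΛ
  have hle : ∀ j, A j + B j ≤ Λ := fun j => by
    have := Finset.single_le_sum (f := fun j => A j + B j)
      (fun i _ => add_nonneg (hA0 i) (hB0 i)) (Finset.mem_univ j)
    linarith
  have hΛ1 : 1 ≤ Λ := by
    have := Finset.sum_nonneg fun j (_ : j ∈ Finset.univ) => add_nonneg (hA0 j) (hB0 j)
    linarith
  have hAΛ : ∀ j, A j ≤ Λ := fun j => by linarith [hle j, hB0 j]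
  have hBΛ : ∀ j, B j ≤ Λ := fun j => by linarith [hle j, hA0 j]
  refine ⟨Λ, hΛ1, fun φ x hx => ⟨?_, fun y hy => ?_⟩⟩
  · rw [← dist_zero_right]
    refine dist_le_of_coord (by linarith) (fun j => ?_) fun j => ?_
    · simpa using ((hA j φ x hx).1).trans (hAΛ j)
    · simpa using ((hB j φ x hx).1).trans (hBΛ j)
  · refine dist_le_of_coord (mul_nonneg (by linarith) dist_nonneg) (fun j => ?_) fun j => ?_
    · exact ((hA j φ x hx).2 y hy).trans (mul_le_mul_of_nonneg_right (hAΛ j) dist_nonneg)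
    · exact ((hB j φ x hx).2 y hy).trans (mul_le_mul_of_nonneg_right (hBΛ j) dist_nonneg)

lemma continuous_field (M : Microgrid N) (x : State N) : Continuous fun φ => M.field φ x := by
  unfold field drive g current
  fun_prop

end Microgrid

/-! ### The oscillator dynamics with clamped amplitudes -/

/-- Restrict the amplitudes of a state to the box `[lo, hi]`. -/
def clamp (lo hi : Fin N → ℝ) (x : State N) : State N :=
  (fun j => max (lo j) (min (hi j) (x.1 j)), x.2)

lemma clamp_mem {lo hi : Fin N → ℝ} (h : ∀ j, lo j ≤ hi j) (x : State N) :
    clamp lo hi x ∈ amplitudeBox lo hi :=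
  fun j => ⟨le_max_left _ _, max_le (h j) (min_le_left _ _)⟩

lemma clamp_of_mem {lo hi : Fin N → ℝ} {x : State N} (hx : x ∈ amplitudeBox lo hi) :
    clamp lo hi x = x := by
  refine Prod.ext (funext fun j => ?_) rfl
  simp [clamp, (hx j).1, (hx j).2]

lemma dist_clamp_le (lo hi : Fin N → ℝ) (x y : State N) :
    dist (clamp lo hi x) (clamp lo hi y) ≤ dist x y := by
  refine dist_le_of_coord dist_nonneg (fun j => ?_) fun j => abs_snd_sub_le x y j
  refine ((abs_max_sub_max_le_max _ _ _ _).trans ?_).trans (abs_fst_sub_le x y j)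
  refine max_le (by simp) ((abs_min_sub_min_le_max _ _ _ _).trans ?_)
  exact max_le (by simp) le_rfl

/-- A bounded, globally Lipschitz vector field has solutions on every compact interval. -/
lemma exists_hasDerivWithinAt_of_bounded_lipschitz {E : Type*} [NormedAddCommGroup E]
    [NormedSpace ℝ E] [CompleteSpace E] {v : ℝ → E → E} {K B T : ℝ} (hT : 0 ≤ T) (hB : 0 ≤ B)
    (hv : ∀ t x y, dist (v t x) (v t y) ≤ K * dist x y) (hc : ∀ x, Continuous fun t => v t x)
    (hb : ∀ t x, ‖v t x‖ ≤ B) (x₀ : E) :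
    ∃ x : ℝ → E, x 0 = x₀ ∧
      ∀ t ∈ Set.Icc 0 T, HasDerivWithinAt x (v t (x t)) (Set.Icc 0 T) t := by
  have hP : IsPicardLindelof v (⟨0, le_rfl, hT⟩ : Set.Icc 0 T) x₀ (B * T).toNNReal 0 B.toNNReal
      K.toNNReal :=
    { lipschitzOnWith := fun t _ => (LipschitzWith.of_dist_le_mul fun x y =>
        (hv t x y).trans (mul_le_mul_of_nonneg_right (Real.le_coe_toNNReal K)
          dist_nonneg)).lipschitzOnWith
      continuousOn := fun x _ => (hc x).continuousOn
      norm_le := fun t _ x _ => (hb t x).trans (Real.le_coe_toNNReal B)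
      mul_max_le := by
        rw [Real.coe_toNNReal _ (mul_nonneg hB hT), Real.coe_toNNReal _ hB]
        simp [hT] }
  exact hP.exists_eq_forall_mem_Icc_hasDerivWithinAt₀

namespace Microgrid

/-- The vector field of the oscillator network at nominal frequency `ω`, with the amplitudes
clamped to `[lo, hi]`. -/
def clampedField (M : Microgrid N) (lo hi : Fin N → ℝ) (ω C t : ℝ) (x : State N) : State N :=
  (1 / C) • M.field (ω * t) (clamp lo hi x)

lemma exists_clampedField_bound (M : Microgrid N) {lo hi : Fin N → ℝ} (hlo : ∀ j, 0 < lo j)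
    (hlh : ∀ j, lo j ≤ hi j) :
    ∃ Λ, 1 ≤ Λ ∧ ∀ C₀ C ω, 0 < C₀ → C₀ ≤ C →
      (∀ t x, ‖M.clampedField lo hi ω C t x‖ ≤ Λ / C₀) ∧
      ∀ t x y, dist (M.clampedField lo hi ω C t x) (M.clampedField lo hi ω C t y)
        ≤ Λ / C₀ * dist x y := by
  obtain ⟨Λ, hΛ1, hΛ⟩ := M.exists_field_bound (hi := hi) hlo
  refine ⟨Λ, hΛ1, fun C₀ C ω hC₀ hC => ?_⟩
  have hC' : 1 / C ≤ 1 / C₀ := one_div_le_one_div_of_le hC₀ hC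
  have hC0 : 0 < 1 / C := one_div_pos.2 (hC₀.trans_le hC)
  refine ⟨fun t x => ?_, fun t x y => ?_⟩
  · rw [clampedField, norm_smul, Real.norm_of_nonneg hC0.le, div_eq_mul_one_div Λ,
      mul_comm Λ]
    exact mul_le_mul hC' (hΛ _ _ (clamp_mem hlh x)).1 (norm_nonneg _) (one_div_pos.2 hC₀).le
  · rw [clampedField, clampedField, dist_smul₀, Real.norm_of_nonneg hC0.le, div_eq_mul_one_div Λ,
      mul_comm Λ, mul_assoc]
    refine mul_le_mul hC' (((hΛ _ _ (clamp_mem hlh x)).2 _ (clamp_mem hlh y)).trans ?_)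
      dist_nonneg (one_div_pos.2 hC₀).le
    exact mul_le_mul_of_nonneg_left (dist_clamp_le lo hi x y) (by linarith)

lemma exists_clamped_solution (M : Microgrid N) {lo hi : Fin N → ℝ} (hlo : ∀ j, 0 < lo j)
    (hlh : ∀ j, lo j ≤ hi j) {C T : ℝ} (hC : 0 < C) (hT : 0 ≤ T) (ω : ℝ) (x₀ : State N) :
    ∃ x : ℝ → State N, x 0 = x₀ ∧ ∀ t ∈ Set.Icc 0 T,
      HasDerivWithinAt x (M.clampedField lo hi ω C t (x t)) (Set.Icc 0 T) t := by
  obtain ⟨Λ, hΛ1, hΛ⟩ := M.exists_clampedField_bound hlo hlh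
  obtain ⟨hb, hl⟩ := hΛ C C ω hC le_rfl
  refine exists_hasDerivWithinAt_of_bounded_lipschitz hT (by positivity) hl (fun x => ?_) hb x₀
  have h : Continuous fun t => M.field (ω * t) (clamp lo hi x) :=
    (M.continuous_field _).comp (continuous_const.mul continuous_id)
  exact h.const_smul (1 / C)

lemma IsVOCSolution.hasDerivWithinAt {M : Microgrid N} {L C T : ℝ} {r θ : ℝ → Fin N → ℝ}
    (h : M.IsVOCSolution L C T r θ) {t : ℝ} (ht : t ∈ Set.Icc 0 T) :
    HasDerivWithinAt (fun s => (r s, θ s)) ((1 / C) • M.field (freq L C * t) (r t, θ t))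
      (Set.Icc 0 T) t := by
  refine HasDerivWithinAt.prodMk (hasDerivWithinAt_pi.2 fun j => ?_)
    (hasDerivWithinAt_pi.2 fun j => ?_)
  · refine (h.amplitude_eq t ht j).congr_deriv ?_
    rw [M.current_eq]
    simp only [Pi.smul_apply, smul_eq_mul, field, drive]
    ring
  · refine (h.phase_eq t ht j).congr_deriv ?_
    rw [M.current_eq]
    simp only [Pi.smul_apply, smul_eq_mul, field, drive]
    ring

lemma isVOCSolution_of_hasDerivWithinAt {M : Microgrid N} {L C T : ℝ} {x : ℝ → State N}
    (hpos : ∀ t ∈ Set.Icc 0 T, ∀ j, 0 < (x t).1 j)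
    (h : ∀ t ∈ Set.Icc 0 T,
      HasDerivWithinAt x ((1 / C) • M.field (freq L C * t) (x t)) (Set.Icc 0 T) t) :
    M.IsVOCSolution L C T (fun t => (x t).1) (fun t => (x t).2) := by
  refine ⟨hpos, fun t ht j => ?_, fun t ht j => ?_⟩
  · have := hasDerivWithinAt_pi.1 ((ContinuousLinearMap.fst ℝ (Fin N → ℝ)
      (Fin N → ℝ)).hasFDerivAt.comp_hasDerivWithinAt t (h t ht)) j
    refine this.congr_deriv ?_
    rw [M.current_eq]
    simp only [ContinuousLinearMap.coe_fst', Prod.smul_fst, Pi.smul_apply, smul_eq_mul, field,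
      drive]
    ring
  · have := hasDerivWithinAt_pi.1 ((ContinuousLinearMap.snd ℝ (Fin N → ℝ)
      (Fin N → ℝ)).hasFDerivAt.comp_hasDerivWithinAt t (h t ht)) j
    refine this.congr_deriv ?_
    rw [M.current_eq]
    simp only [ContinuousLinearMap.coe_snd', Prod.smul_snd, Pi.smul_apply, smul_eq_mul, field,
      drive]
    ring

/-- The amplitudes of a solution stay in a compact subset of `(0, ∞)`, on which the vector field
is Lipschitz; hence solutions are determined by their initial data. -/
lemma IsVOCSolution.eqOn {M : Microgrid N} {L C T : ℝ} (hC : 0 < C) (hT : 0 ≤ T)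
    {r θ r' θ' : ℝ → Fin N → ℝ} (h : M.IsVOCSolution L C T r θ) (h' : M.IsVOCSolution L C T r' θ')
    (hr : r 0 = r' 0) (hθ : θ 0 = θ' 0) :
    Set.EqOn (fun s => (r s, θ s)) (fun s => (r' s, θ' s)) (Set.Icc 0 T) := by
  have hrange : ∀ {r θ : ℝ → Fin N → ℝ}, M.IsVOCSolution L C T r θ → ∀ j, ∃ a b, 0 < a ∧
      ∀ t ∈ Set.Icc 0 T, r t j ∈ Set.Icc a b := by
    intro r θ h j
    have hc : ContinuousOn (fun t => r t j) (Set.Icc 0 T) := fun t ht =>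
      (h.amplitude_eq t ht j).continuousWithinAt
    have hne : (Set.Icc 0 T).Nonempty := Set.nonempty_Icc.2 hT
    obtain ⟨s, hs, hmin⟩ := isCompact_Icc.exists_isMinOn hne hc
    obtain ⟨u, -, hmax⟩ := isCompact_Icc.exists_isMaxOn hne hc
    exact ⟨r s j, r u j, h.amplitude_pos s hs j, fun t ht => ⟨hmin ht, hmax ht⟩⟩
  choose a b ha hab using hrange h
  choose a' b' ha' hab' using hrange h'
  set lo : Fin N → ℝ := fun j => min (a j) (a' j) with hlo
  set hi : Fin N → ℝ := fun j => max (b j) (b' j) with hhi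
  have hm : ∀ t ∈ Set.Icc 0 T, (r t, θ t) ∈ amplitudeBox lo hi := fun t ht j =>
    ⟨(min_le_left _ _).trans (hab j t ht).1, (hab j t ht).2.trans (le_max_left _ _)⟩
  have hm' : ∀ t ∈ Set.Icc 0 T, (r' t, θ' t) ∈ amplitudeBox lo hi := fun t ht j =>
    ⟨(min_le_right _ _).trans (hab' j t ht).1, (hab' j t ht).2.trans (le_max_right _ _)⟩
  have h0 : (0 : ℝ) ∈ Set.Icc 0 T := ⟨le_rfl, hT⟩
  obtain ⟨Λ, hΛ1, hΛ⟩ := M.exists_clampedField_bound (lo := lo) (hi := hi)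
    (fun j => lt_min (ha j) (ha' j)) fun j => (hm 0 h0 j).1.trans (hm 0 h0 j).2
  have hlip : ∀ t, LipschitzWith (Λ / C).toNNReal (M.clampedField lo hi (freq L C) C t) := fun t =>
    LipschitzWith.of_dist_le_mul fun x y => by
      rw [Real.coe_toNNReal _ (by positivity)]
      exact (hΛ C C (freq L C) hC le_rfl).2 t x y
  have key : ∀ {r θ : ℝ → Fin N → ℝ}, M.IsVOCSolution L C T r θ →
      (∀ t ∈ Set.Icc 0 T, (r t, θ t) ∈ amplitudeBox lo hi) →
      ContinuousOn (fun s => (r s, θ s)) (Set.Icc 0 T) ∧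
      ∀ t ∈ Set.Ico 0 T, HasDerivWithinAt (fun s => (r s, θ s))
        (M.clampedField lo hi (freq L C) C t (r t, θ t)) (Set.Ici t) t := by
    intro r θ h hm
    refine ⟨fun t ht => (h.hasDerivWithinAt ht).continuousWithinAt, fun t ht => ?_⟩
    have := h.hasDerivWithinAt (Set.Ico_subset_Icc_self ht)
    rw [← clamp_of_mem (hm t (Set.Ico_subset_Icc_self ht))] at this
    exact this.mono_of_mem_nhdsWithin (Icc_mem_nhdsGE_of_mem ht)
  obtain ⟨hc, hd⟩ := key h hm
  obtain ⟨hc', hd'⟩ := key h' hm'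
  exact ODE_solution_unique_of_mem_Icc_right (s := fun _ => Set.univ)
    (fun t _ => (hlip t).lipschitzOnWith) hc hd (fun _ _ => trivial) hc' hd'
    (fun _ _ => trivial) (Prod.ext hr hθ)

end Microgrid

/-! ### Oscillating perturbations -/

/-- On `[0, T]`, `f / C` is, up to an error `c ε`, the derivative of a function bounded by `c ε`. -/
def IsOsc (ε C T c : ℝ) (f : ℝ → ℝ) : Prop :=
  ∃ w w' : ℝ → ℝ, ∀ t ∈ Set.Icc 0 T, HasDerivWithinAt w (w' t) (Set.Icc 0 T) t ∧
    |w t| ≤ c * ε ∧ |w' t - f t / C| ≤ c * ε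

namespace IsOsc

variable {ε C T c d : ℝ} {f g : ℝ → ℝ}

lemma add (hf : IsOsc ε C T c f) (hg : IsOsc ε C T d g) :
    IsOsc ε C T (c + d) (fun t => f t + g t) := by
  obtain ⟨w, w', h⟩ := hf
  obtain ⟨u, u', k⟩ := hg
  refine ⟨fun t => w t + u t, fun t => w' t + u' t, fun t ht => ⟨(h t ht).1.add (k t ht).1, ?_, ?_⟩⟩
  · rw [add_mul]
    exact (abs_add_le _ _).trans (add_le_add (h t ht).2.1 (k t ht).2.1)
  · rw [add_mul, show w' t + u' t - (f t + g t) / C = (w' t - f t / C) + (u' t - g t / C) by ring]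
    exact (abs_add_le _ _).trans (add_le_add (h t ht).2.2 (k t ht).2.2)

lemma const_mul {k k' : ℝ} (hk : |k| ≤ k') (hf : IsOsc ε C T c f) :
    IsOsc ε C T (k' * c) (fun t => k * f t) := by
  obtain ⟨w, w', h⟩ := hf
  have hk' : 0 ≤ k' := (abs_nonneg k).trans hk
  refine ⟨fun t => k * w t, fun t => k * w' t, fun t ht => ⟨(h t ht).1.const_mul k, ?_, ?_⟩⟩
  · rw [abs_mul, mul_assoc]
    exact mul_le_mul hk (h t ht).2.1 (abs_nonneg _) hk'
  · rw [show k * w' t - k * f t / C = k * (w' t - f t / C) by ring, abs_mul, mul_assoc]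
    exact mul_le_mul hk (h t ht).2.2 (abs_nonneg _) hk'

/-- `IsOsc` tolerates perturbations of size `C ε`. -/
lemma of_close (hf : IsOsc ε C T c f) (hd : 0 ≤ d * ε)
    (hfg : ∀ t ∈ Set.Icc 0 T, |f t / C - g t / C| ≤ d * ε) :
    IsOsc ε C T (c + d) g := by
  obtain ⟨w, w', h⟩ := hf
  refine ⟨w, w', fun t ht => ⟨(h t ht).1, ?_, ?_⟩⟩
  · rw [add_mul]
    linarith [(h t ht).2.1]
  · rw [add_mul, show w' t - g t / C = (w' t - f t / C) + (f t / C - g t / C) by ring]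
    exact (abs_add_le _ _).trans (add_le_add (h t ht).2.2 (hfg t ht))

lemma congr (hf : IsOsc ε C T c f) (h : ∀ t ∈ Set.Icc 0 T, f t = g t) : IsOsc ε C T c g := by
  obtain ⟨w, w', k⟩ := hf
  exact ⟨w, w', fun t ht => by rw [← h t ht]; exact k t ht⟩

lemma mono (hε : 0 ≤ ε) (hf : IsOsc ε C T c f) (h : c ≤ d) : IsOsc ε C T d f := by
  obtain ⟨w, w', k⟩ := hf
  have := mul_le_mul_of_nonneg_right h hε
  exact ⟨w, w', fun t ht => ⟨(k t ht).1, (k t ht).2.1.trans this, (k t ht).2.2.trans this⟩⟩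

lemma sum {ι : Type*} (s : Finset ι) {f : ι → ℝ → ℝ} {c : ι → ℝ}
    (hf : ∀ i ∈ s, IsOsc ε C T (c i) (f i)) :
    IsOsc ε C T (∑ i ∈ s, c i) (fun t => ∑ i ∈ s, f i t) := by
  classical
  induction s using Finset.induction_on with
  | empty => exact ⟨0, 0, fun t _ => ⟨hasDerivWithinAt_const _ _ _, by simp, by simp⟩⟩
  | insert i s hi ih =>
    simp only [Finset.sum_insert hi]
    exact (hf i (Finset.mem_insert_self i s)).add
      (ih fun k hk => hf k (Finset.mem_insert_of_mem hk))

end IsOsc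

/-- `ψ` is differentiable on `[0, T]` with derivative bounded by `D`. -/
def SlowOn (T D : ℝ) (ψ : ℝ → ℝ) : Prop :=
  ∃ ψ' : ℝ → ℝ, ∀ t ∈ Set.Icc 0 T, HasDerivWithinAt ψ (ψ' t) (Set.Icc 0 T) t ∧ |ψ' t| ≤ D

namespace SlowOn

variable {T D D' : ℝ} {ψ χ : ℝ → ℝ}

lemma const (c : ℝ) (hD : 0 ≤ D) : SlowOn T D (fun _ => c) :=
  ⟨0, fun _ _ => ⟨hasDerivWithinAt_const _ _ _, by simpa⟩⟩

lemma add (h : SlowOn T D ψ) (k : SlowOn T D' χ) : SlowOn T (D + D') (fun t => ψ t + χ t) := by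
  obtain ⟨ψ', h⟩ := h
  obtain ⟨χ', k⟩ := k
  exact ⟨fun t => ψ' t + χ' t, fun t ht => ⟨(h t ht).1.add (k t ht).1,
    (abs_add_le _ _).trans (add_le_add (h t ht).2 (k t ht).2)⟩⟩

end SlowOn

/-- A harmonic with slowly varying phase: integrate by parts once, with `ε = 1 / (ω C)`. -/
lemma SlowOn.isOsc_cos {ω ε C T D n : ℝ} {ψ : ℝ → ℝ} (hψ : SlowOn T D ψ) (hε : 0 ≤ ε)
    (hω : ε * ω = 1 / C) (hn : 1 ≤ n) (hD : 0 ≤ D) :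
    IsOsc ε C T (1 + D) (fun t => Real.cos (n * (ω * t) + ψ t)) := by
  obtain ⟨ψ', h⟩ := hψ
  have hnε : 0 ≤ ε / n := by positivity
  have hnε' : ε / n ≤ ε := div_le_self hε hn
  refine ⟨fun t => ε / n * Real.sin (n * (ω * t) + ψ t),
    fun t => ε / n * (Real.cos (n * (ω * t) + ψ t) * (n * (ω * 1) + ψ' t)),
    fun t ht => ⟨?_, ?_, ?_⟩⟩
  · exact (((((hasDerivWithinAt_id t _).const_mul ω).const_mul n).add (h t ht).1).sin).const_mul _
  · rw [abs_mul, abs_of_nonneg hnε]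
    calc ε / n * |Real.sin (n * (ω * t) + ψ t)| ≤ ε * 1 :=
          mul_le_mul hnε' (Real.abs_sin_le_one _) (abs_nonneg _) hε
      _ ≤ (1 + D) * ε := by nlinarith
  · have e : ε / n * (Real.cos (n * (ω * t) + ψ t) * (n * (ω * 1) + ψ' t))
        - Real.cos (n * (ω * t) + ψ t) / C
        = ε / n * (Real.cos (n * (ω * t) + ψ t) * ψ' t) := by
      have hn0 : n ≠ 0 := by positivity
      have : Real.cos (n * (ω * t) + ψ t) / C = Real.cos (n * (ω * t) + ψ t) * (ε * ω) := by
        rw [hω]; ring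
      rw [this]
      field_simp
      ring
    rw [e, abs_mul, abs_mul, abs_of_nonneg hnε]
    calc ε / n * (|Real.cos (n * (ω * t) + ψ t)| * |ψ' t|) ≤ ε * (1 * D) :=
          mul_le_mul hnε' (mul_le_mul (Real.abs_cos_le_one _) (h t ht).2 (abs_nonneg _)
            zero_le_one) (by positivity) hε
      _ ≤ (1 + D) * ε := by nlinarith

section Harmonics

variable {ω ε C T D : ℝ} {a b : ℝ → ℝ}

lemma SlowOn.isOsc_sin {n : ℝ} {ψ : ℝ → ℝ} (hψ : SlowOn T D ψ) (hε : 0 ≤ ε)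
    (hω : ε * ω = 1 / C) (hn : 1 ≤ n) (hD : 0 ≤ D) :
    IsOsc ε C T (1 + D) (fun t => Real.sin (n * (ω * t) + ψ t)) := by
  have h := (hψ.add (SlowOn.const (-(Real.pi / 2)) le_rfl)).isOsc_cos hε hω hn (by simpa using hD)
  rw [add_zero] at h
  refine h.congr fun t _ => ?_
  rw [← add_assoc, ← sub_eq_add_neg, Real.cos_sub_pi_div_two]

lemma isOsc_cos_mul_cos (ha : SlowOn T D a) (hb : SlowOn T D b) (hε : 0 ≤ ε)
    (hω : ε * ω = 1 / C) (hD : 0 ≤ D) :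
    IsOsc ε C T (1 + 4 * D)
      (fun t => Real.cos (ω * t + a t) * Real.cos (ω * t + b t) - Real.cos (a t - b t) / 2) := by
  have h := ((ha.add hb).isOsc_cos hε hω one_le_two (by positivity)).const_mul
    (le_refl |(1 / 2 : ℝ)|)
  refine (h.mono hε (d := 1 + 4 * D) ?_).congr fun t _ => ?_
  · rw [abs_of_pos (by norm_num)]; linarith
  · rw [show a t - b t = (ω * t + a t) - (ω * t + b t) by ring,
      show 2 * (ω * t) + (a t + b t) = (ω * t + a t) + (ω * t + b t) by ring,
      Real.cos_add (ω * t + a t), Real.cos_sub]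
    ring

lemma isOsc_sin_mul_cos (ha : SlowOn T D a) (hb : SlowOn T D b) (hε : 0 ≤ ε)
    (hω : ε * ω = 1 / C) (hD : 0 ≤ D) :
    IsOsc ε C T (1 + 4 * D)
      (fun t => Real.sin (ω * t + a t) * Real.cos (ω * t + b t) - Real.sin (a t - b t) / 2) := by
  have h := ((ha.add hb).isOsc_sin hε hω one_le_two (by positivity)).const_mul
    (le_refl |(1 / 2 : ℝ)|)
  refine (h.mono hε (d := 1 + 4 * D) ?_).congr fun t _ => ?_
  · rw [abs_of_pos (by norm_num)]; linarith
  · rw [show a t - b t = (ω * t + a t) - (ω * t + b t) by ring,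
      show 2 * (ω * t) + (a t + b t) = (ω * t + a t) + (ω * t + b t) by ring,
      Real.sin_add (ω * t + a t), Real.sin_sub]
    ring

lemma isOsc_cos_pow_four (ha : SlowOn T D a) (hε : 0 ≤ ε) (hω : ε * ω = 1 / C) (hD : 0 ≤ D) :
    IsOsc ε C T (1 + 4 * D) (fun t => Real.cos (ω * t + a t) ^ 4 - 3 / 8) := by
  have h2 := ((ha.add ha).isOsc_cos hε hω one_le_two (by positivity)).const_mul
    (le_refl |(1 / 2 : ℝ)|)
  have h4 := (((ha.add ha).add (ha.add ha)).isOsc_cos hε hω (n := 4) (by norm_num)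
    (by positivity)).const_mul (le_refl |(1 / 8 : ℝ)|)
  refine ((h2.add h4).mono hε (d := 1 + 4 * D) ?_).congr fun t _ => ?_
  · rw [abs_of_pos (by norm_num), abs_of_pos (by norm_num)]; linarith
  · rw [show 4 * (ω * t) + (a t + a t + (a t + a t)) = 2 * (2 * (ω * t + a t)) by ring,
      show 2 * (ω * t) + (a t + a t) = 2 * (ω * t + a t) by ring, Real.cos_two_mul (2 * _),
      Real.cos_two_mul]
    ring

lemma isOsc_cos_pow_three_mul_sin (ha : SlowOn T D a) (hε : 0 ≤ ε) (hω : ε * ω = 1 / C)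
    (hD : 0 ≤ D) :
    IsOsc ε C T (1 + 4 * D) (fun t => Real.cos (ω * t + a t) ^ 3 * Real.sin (ω * t + a t)) := by
  have h2 := ((ha.add ha).isOsc_sin hε hω one_le_two (by positivity)).const_mul
    (le_refl |(1 / 4 : ℝ)|)
  have h4 := (((ha.add ha).add (ha.add ha)).isOsc_sin hε hω (n := 4) (by norm_num)
    (by positivity)).const_mul (le_refl |(1 / 8 : ℝ)|)
  refine ((h2.add h4).mono hε (d := 1 + 4 * D) ?_).congr fun t _ => ?_
  · rw [abs_of_pos (by norm_num), abs_of_pos (by norm_num)]; linarith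
  · rw [show 4 * (ω * t) + (a t + a t + (a t + a t)) = 2 * (2 * (ω * t + a t)) by ring,
      show 2 * (ω * t) + (a t + a t) = 2 * (ω * t + a t) by ring, Real.sin_two_mul (2 * _),
      Real.cos_two_mul, Real.sin_two_mul]
    ring

end Harmonics

/-! ### The averaging estimate -/

namespace Microgrid

/-- First-order averaging for the clamped network: if along `y` the defect `C y' - field` is
oscillating, then `y` shadows the clamped solutions that start nearby. The near-identity change of
variables `y + w`, with `w` the primitive of the oscillation, is an approximate solution, to which
Grönwall's inequality applies. -/
lemma dist_clamped_solution_le (M : Microgrid N) {lo hi : Fin N → ℝ} {ω ε C T c k K : ℝ}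
    (hε : 0 ≤ ε) (hC : 0 < C) (hc : 0 ≤ c) (hk : 0 ≤ k) (hK : 0 < K)
    (hlip : ∀ t x y, dist (M.clampedField lo hi ω C t x) (M.clampedField lo hi ω C t y)
      ≤ K * dist x y)
    {x y y' : ℝ → State N}
    (hx : ∀ t ∈ Set.Icc 0 T,
      HasDerivWithinAt x (M.clampedField lo hi ω C t (x t)) (Set.Icc 0 T) t)
    (hy : ∀ t ∈ Set.Icc 0 T, HasDerivWithinAt y (y' t) (Set.Icc 0 T) t)
    (hbox : ∀ t ∈ Set.Icc 0 T, y t ∈ amplitudeBox lo hi)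
    (h1 : ∀ j, IsOsc ε C T c (fun t => (M.field (ω * t) (y t)).1 j - C * (y' t).1 j))
    (h2 : ∀ j, IsOsc ε C T c (fun t => (M.field (ω * t) (y t)).2 j - C * (y' t).2 j))
    (h0 : dist (x 0) (y 0) ≤ k * ε) :
    ∀ t ∈ Set.Icc 0 T,
      dist (x t) (y t) ≤ ((k + c + (c + K * c) / K) * Real.exp (K * T) + c) * ε := by
  choose w₁ w₁' hw₁ using h1
  choose w₂ w₂' hw₂ using h2
  set w : ℝ → State N := fun t => (fun j => w₁ j t, fun j => w₂ j t) with hw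
  set w' : ℝ → State N := fun t => (fun j => w₁' j t, fun j => w₂' j t) with hw'
  have hcε : 0 ≤ c * ε := mul_nonneg hc hε
  have hwd : ∀ t ∈ Set.Icc 0 T, HasDerivWithinAt w (w' t) (Set.Icc 0 T) t := fun t ht =>
    HasDerivWithinAt.prodMk (hasDerivWithinAt_pi.2 fun j => (hw₁ j t ht).1)
      (hasDerivWithinAt_pi.2 fun j => (hw₂ j t ht).1)
  have hwy : ∀ t ∈ Set.Icc 0 T, dist (y t + w t) (y t) ≤ c * ε := fun t ht => by
    refine dist_le_of_coord hcε (fun j => ?_) fun j => ?_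
    · simpa [hw] using (hw₁ j t ht).2.1
    · simpa [hw] using (hw₂ j t ht).2.1
  have hres : ∀ t ∈ Set.Icc 0 T,
      dist (y' t + w' t) (M.clampedField lo hi ω C t (y t + w t)) ≤ (c + K * c) * ε := by
    intro t ht
    have e1 : dist (y' t + w' t) (M.clampedField lo hi ω C t (y t)) ≤ c * ε := by
      rw [clampedField, clamp_of_mem (hbox t ht)]
      refine dist_le_of_coord hcε (fun j => ?_) fun j => ?_
      · convert (hw₁ j t ht).2.2 using 2
        simp only [Prod.fst_add, Pi.add_apply, Prod.smul_fst, Pi.smul_apply, smul_eq_mul, hw']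
        field_simp
        ring
      · convert (hw₂ j t ht).2.2 using 2
        simp only [Prod.snd_add, Pi.add_apply, Prod.smul_snd, Pi.smul_apply, smul_eq_mul, hw']
        field_simp
        ring
    have e2 := hlip t (y t) (y t + w t)
    rw [dist_comm (y t)] at e2
    have e3 := mul_le_mul_of_nonneg_left (hwy t ht) hK.le
    have e4 := dist_triangle (y' t + w' t) (M.clampedField lo hi ω C t (y t))
      (M.clampedField lo hi ω C t (y t + w t))
    linarith
  have hIci : ∀ {z : ℝ → State N} {z' : State N} {t : ℝ}, t ∈ Set.Ico 0 T →
      HasDerivWithinAt z z' (Set.Icc 0 T) t → HasDerivWithinAt z z' (Set.Ici t) t :=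
    fun ht h => h.mono_of_mem_nhdsWithin (Icc_mem_nhdsGE_of_mem ht)
  intro t ht
  have hT0 : (0 : ℝ) ∈ Set.Icc 0 T := ⟨le_rfl, ht.1.trans ht.2⟩
  have hyw : ∀ t ∈ Set.Icc 0 T,
      HasDerivWithinAt (fun t => y t + w t) (y' t + w' t) (Set.Icc 0 T) t := fun t ht =>
    (hy t ht).add (hwd t ht)
  have hG := dist_le_of_approx_trajectories_ODE (v := M.clampedField lo hi ω C)
    (K := K.toNNReal) (f := x) (g := fun t => y t + w t)
    (f' := fun t => M.clampedField lo hi ω C t (x t)) (g' := fun t => y' t + w' t)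
    (a := 0) (b := T) (εf := 0) (εg := (c + K * c) * ε) (δ := (k + c) * ε)
    (fun t => LipschitzWith.of_dist_le_mul fun x y => by
      rw [Real.coe_toNNReal _ hK.le]; exact hlip t x y)
    (fun t ht => (hx t ht).continuousWithinAt)
    (fun t ht => hIci ht (hx t (Set.Ico_subset_Icc_self ht)))
    (fun t _ => (dist_self _).le)
    (fun t ht => (hyw t ht).continuousWithinAt)
    (fun t ht => hIci ht (hyw t (Set.Ico_subset_Icc_self ht)))
    (fun t ht => hres t (Set.Ico_subset_Icc_self ht))
    (by
      have := dist_triangle (x 0) (y 0) (y 0 + w 0)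
      have h := hwy 0 hT0
      rw [dist_comm] at h
      linarith) t ht
  rw [Real.coe_toNNReal _ hK.le, gronwallBound_of_K_ne_0 hK.ne', zero_add, sub_zero] at hG
  have hexp : Real.exp (K * t) ≤ Real.exp (K * T) :=
    Real.exp_le_exp.2 (mul_le_mul_of_nonneg_left ht.2 hK.le)
  have hA : 0 ≤ (k + c) * ε := by positivity
  have hB : 0 ≤ (c + K * c) * ε / K := by positivity
  have e1 := mul_le_mul_of_nonneg_left hexp hA
  have e2 := mul_le_mul_of_nonneg_left (show Real.exp (K * t) - 1 ≤ Real.exp (K * T) by linarith) hB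
  have e3 := dist_triangle (x t) (y t + w t) (y t)
  have e4 := hwy t ht
  have e5 : ((k + c + (c + K * c) / K) * Real.exp (K * T) + c) * ε
      = (k + c) * ε * Real.exp (K * T) + (c + K * c) * ε / K * Real.exp (K * T) + c * ε := by
    ring
  linarith

end Microgrid

/-! ### Average power and the averaged vector field -/

lemma integral_cos_mul_cos (a b : ℝ) :
    ∫ u in (0 : ℝ)..(2 * Real.pi), Real.cos (u + a) * Real.cos (u + b)
      = Real.pi * Real.cos (a - b) := by
  have h : ∀ u ∈ Set.uIcc 0 (2 * Real.pi), HasDerivAt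
      (fun u : ℝ => Real.cos (a - b) / 2 * u + Real.sin (2 * u + (a + b)) / 4)
      (Real.cos (u + a) * Real.cos (u + b)) u := by
    intro u _
    have h1 := (((hasDerivAt_id u).const_mul 2).add_const (a + b)).sin.div_const 4
    refine (((hasDerivAt_id u).const_mul (Real.cos (a - b) / 2)).add h1).congr_deriv ?_
    simp only [id]
    rw [show a - b = (u + a) - (u + b) by ring, show 2 * u + (a + b) = (u + a) + (u + b) by ring,
      Real.cos_add (u + a), Real.cos_sub (u + a)]
    ring
  rw [intervalIntegral.integral_eq_sub_of_hasDerivAt h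
    (Continuous.intervalIntegrable (by fun_prop) _ _),
    show 2 * (2 * Real.pi) + (a + b) = a + b + (2 : ℕ) * (2 * Real.pi) by push_cast; ring,
    Real.sin_add_nat_mul_two_pi, mul_zero 2, zero_add]
  ring

lemma integral_sin_mul_cos (a b : ℝ) :
    ∫ u in (0 : ℝ)..(2 * Real.pi), Real.sin (u + a) * Real.cos (u + b)
      = Real.pi * Real.sin (a - b) := by
  have h := integral_cos_mul_cos (a - Real.pi / 2) b
  simp only [← add_sub_assoc, Real.cos_sub_pi_div_two] at h
  rw [h, show a - Real.pi / 2 - b = a - b - Real.pi / 2 by ring, Real.cos_sub_pi_div_two]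

namespace Microgrid

/-- The cycle average of the injected current against a waveform `W`, given the cycle averages of
`W` against all harmonics at the nominal frequency. -/
lemma average_current (M : Microgrid N) {ω : ℝ} (hω : 0 < ω) {W w : ℝ → ℝ} (hW : Continuous W)
    (hw : ∀ b, ∫ u in (0 : ℝ)..(2 * Real.pi), W u * Real.cos (u + b) = Real.pi * w b)
    (ρ : ℝ) (r θ : Fin N → ℝ) (j : Fin N) :
    ω / (2 * Real.pi) *
        ∫ s in (0 : ℝ)..(2 * Real.pi / ω), ρ * W (ω * s) * M.current ω r θ s j
      = ρ * ((∑ l, M.G j l * (r l * w (θ l)) + M.ι j * w (M.γ j)) / 2) := by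
  have h1 : (fun s => ρ * W (ω * s) * M.current ω r θ s j)
      = fun s => (fun u => ρ * W u * M.current 1 r θ u j) (ω * s) := by
    funext s
    rw [M.current_eq]
  have h2 : ∫ u in (0 : ℝ)..(2 * Real.pi), ρ * W u * M.current 1 r θ u j
      = ρ * (∑ l, M.G j l * (r l * (Real.pi * w (θ l))) + M.ι j * (Real.pi * w (M.γ j))) := by
    have hI : ∀ b, IntervalIntegrable (fun u => W u * Real.cos (u + b)) MeasureTheory.volume 0
        (2 * Real.pi) := fun b => Continuous.intervalIntegrable (by fun_prop) _ _
    have e : (fun u => ρ * W u * M.current 1 r θ u j) = fun u =>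
        ρ * (∑ l, M.G j l * (r l * (W u * Real.cos (u + θ l)))
          + M.ι j * (W u * Real.cos (u + M.γ j))) := by
      funext u
      simp only [current, one_mul]
      rw [mul_assoc, mul_add, Finset.mul_sum]
      congr 2
      · exact Finset.sum_congr rfl fun l _ => by ring
      · ring
    rw [e, intervalIntegral.integral_const_mul, intervalIntegral.integral_add,
      intervalIntegral.integral_finsetSum]
    · simp only [intervalIntegral.integral_const_mul, hw]
    · exact fun l _ => ((hI _).const_mul _).const_mul _
    · exact Continuous.intervalIntegrable (by fun_prop) _ _
    · exact (hI _).const_mul _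
  rw [h1, intervalIntegral.integral_comp_mul_left (fun u => ρ * W u * M.current 1 r θ u j) hω.ne', mul_zero,
    mul_div_cancel₀ _ hω.ne', h2, smul_eq_mul]
  have e : ∑ l, M.G j l * (r l * (Real.pi * w (θ l))) + M.ι j * (Real.pi * w (M.γ j))
      = Real.pi * (∑ l, M.G j l * (r l * w (θ l)) + M.ι j * w (M.γ j)) := by
    rw [mul_add, Finset.mul_sum]
    congr 1
    · exact Finset.sum_congr rfl fun l _ => by ring
    · ring
  rw [e]
  have := Real.pi_pos
  field_simp

lemma avgP_eq (M : Microgrid N) {ω : ℝ} (hω : 0 < ω) (r θ : Fin N → ℝ) (j : Fin N) :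
    M.avgP ω r θ j = r j * ((∑ l, M.G j l * (r l * Real.cos (θ j - θ l))
      + M.ι j * Real.cos (θ j - M.γ j)) / 2) :=
  M.average_current hω (W := fun u => Real.cos (u + θ j)) (w := fun b => Real.cos (θ j - b))
    (by fun_prop) (fun b => integral_cos_mul_cos _ _) _ _ _ _

lemma avgQ_eq (M : Microgrid N) {ω : ℝ} (hω : 0 < ω) (r θ : Fin N → ℝ) (j : Fin N) :
    M.avgQ ω r θ j = r j * ((∑ l, M.G j l * (r l * Real.sin (θ j - θ l))
      + M.ι j * Real.sin (θ j - M.γ j)) / 2) :=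
  M.average_current hω (W := fun u => Real.sin (u + θ j)) (w := fun b => Real.sin (θ j - b))
    (by fun_prop) (fun b => integral_sin_mul_cos _ _) _ _ _ _

/-- A bound of the current amplitude at inverter `j` for voltage amplitudes at most `hi`. -/
def currentBound (M : Microgrid N) (hi : Fin N → ℝ) (j : Fin N) : ℝ :=
  ∑ l, |M.G j l| * hi l + |M.ι j|

lemma currentBound_nonneg (M : Microgrid N) {hi : Fin N → ℝ} (h : ∀ l, 0 ≤ hi l) (j : Fin N) :
    0 ≤ M.currentBound hi j :=
  add_nonneg (Finset.sum_nonneg fun l _ => mul_nonneg (abs_nonneg _) (h l)) (abs_nonneg _)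

lemma abs_avgQ_le (M : Microgrid N) {ω : ℝ} (hω : 0 < ω) {r θ hi : Fin N → ℝ}
    (hr : ∀ l, |r l| ≤ hi l) (j : Fin N) : |M.avgQ ω r θ j| ≤ hi j * M.currentBound hi j := by
  have hi0 : ∀ l, 0 ≤ hi l := fun l => (abs_nonneg _).trans (hr l)
  have h1 : |∑ l, M.G j l * (r l * Real.sin (θ j - θ l)) + M.ι j * Real.sin (θ j - M.γ j)|
      ≤ M.currentBound hi j := by
    refine (abs_add_le _ _).trans (add_le_add ((Finset.abs_sum_le_sum_abs _ _).trans
      (Finset.sum_le_sum fun l _ => ?_)) ?_)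
    · rw [abs_mul, abs_mul]
      refine mul_le_mul_of_nonneg_left ?_ (abs_nonneg _)
      calc |r l| * |Real.sin (θ j - θ l)| ≤ hi l * 1 :=
            mul_le_mul (hr l) (Real.abs_sin_le_one _) (abs_nonneg _) (hi0 l)
        _ = hi l := mul_one _
    · rw [abs_mul]
      exact mul_le_of_le_one_right (abs_nonneg _) (Real.abs_sin_le_one _)
  rw [M.avgQ_eq hω, abs_mul, abs_div, abs_two]
  refine mul_le_mul (hr j) ?_ (by positivity) (hi0 j)
  linarith [abs_nonneg (∑ l, M.G j l * (r l * Real.sin (θ j - θ l))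
    + M.ι j * Real.sin (θ j - M.γ j))]

section Osc

variable {ω ε C T D : ℝ} {r lo hi : Fin N → ℝ} {θ : ℝ → Fin N → ℝ}

/-- The injected current demodulated by `W` is its cycle average up to oscillations. -/
lemma isOsc_current (M : Microgrid N) (hD : 0 ≤ D) (hr : ∀ l, |r l| ≤ hi l) {W : ℝ → ℝ}
    {w : ℝ → ℝ → ℝ} {c : ℝ} (hθ : ∀ l, SlowOn T D (fun t => θ t l))
    (hW : ∀ b : ℝ → ℝ, SlowOn T D b →
      IsOsc ε C T c (fun t => W t * Real.cos (ω * t + b t) - w t (b t) / 2)) (j : Fin N) :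
    IsOsc ε C T (M.currentBound hi j * c) (fun t => W t * M.current 1 r (θ t) (ω * t) j
      - (∑ l, M.G j l * (r l * w t (θ t l)) + M.ι j * w t (M.γ j)) / 2) := by
  have h1 := IsOsc.sum Finset.univ fun l _ =>
    (hW _ (hθ l)).const_mul (k := M.G j l * r l) (k' := |M.G j l| * hi l)
      (by rw [abs_mul]; exact mul_le_mul_of_nonneg_left (hr l) (abs_nonneg _))
  have h2 := (hW _ (SlowOn.const (M.γ j) hD)).const_mul (le_refl |M.ι j|)
  have h3 := h1.add h2
  rw [← Finset.sum_mul, ← add_mul] at h3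
  refine h3.congr fun t _ => ?_
  simp only [current, one_mul, mul_add, add_div, Finset.mul_sum, Finset.sum_div]
  rw [add_sub_add_comm, ← Finset.sum_sub_distrib]
  congr 1
  · exact Finset.sum_congr rfl fun l _ => by ring
  · ring

lemma isOsc_field_fst (M : Microgrid N) (hε : 0 ≤ ε) (hω : ε * ω = 1 / C) (hω0 : 0 < ω)
    (hD : 0 ≤ D) (hlo : ∀ l, 0 < lo l) (hr : ∀ l, r l ∈ Set.Icc (lo l) (hi l))
    (hθ : ∀ l, SlowOn T D (fun t => θ t l)) (j : Fin N) :
    IsOsc ε C T ((|M.α| * hi j + |M.α * M.β| * hi j ^ 3 + |M.κ j| * M.currentBound hi j)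
        * (1 + 4 * D))
      (fun t => (M.field (ω * t) (r, θ t)).1 j
        - (M.α / 2 * (r j - M.β / 4 * r j ^ 3) - M.κ j * M.avgP ω r (θ t) j / r j)) := by
  have hr0 : ∀ l, 0 < r l := fun l => (hlo l).trans_le (hr l).1
  have hra : ∀ l, |r l| ≤ hi l := fun l => by rw [abs_of_pos (hr0 l)]; exact (hr l).2
  have h1 := (isOsc_cos_mul_cos (hθ j) (hθ j) hε hω hD).const_mul (k := M.α * r j)
    (k' := |M.α| * hi j) (by
      rw [abs_mul]; exact mul_le_mul_of_nonneg_left (hra j) (abs_nonneg _))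
  have h2 := (isOsc_cos_pow_four (hθ j) hε hω hD).const_mul (k := -(M.α * M.β / 3 * r j ^ 3))
    (k' := |M.α * M.β| * hi j ^ 3) (by
      rw [abs_neg, abs_mul, abs_pow, abs_div, abs_of_pos (by norm_num : (0 : ℝ) < 3)]
      exact mul_le_mul (div_le_self (abs_nonneg _) (by norm_num))
        (pow_le_pow_left₀ (abs_nonneg _) (hra j) 3) (by positivity) (abs_nonneg _))
  have h3 := (M.isOsc_current hD hra hθ (w := fun t b => Real.cos (θ t j - b))
    (fun b hb => isOsc_cos_mul_cos (hθ j) hb hε hω hD) j).const_mul (k := -M.κ j)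
    (k' := |M.κ j|) (by rw [abs_neg])
  rw [← mul_assoc] at h3
  have h := (h1.add h2).add h3
  rw [← add_mul, ← add_mul] at h
  refine h.congr fun t _ => ?_
  rw [M.avgP_eq hω0]
  simp only [field, drive, g, sub_self, Real.cos_zero]
  have := (hr0 j).ne'
  field_simp
  ring

lemma isOsc_field_snd (M : Microgrid N) (hε : 0 ≤ ε) (hω : ε * ω = 1 / C) (hω0 : 0 < ω)
    (hD : 0 ≤ D) (hlo : ∀ l, 0 < lo l) (hr : ∀ l, r l ∈ Set.Icc (lo l) (hi l))
    (hθ : ∀ l, SlowOn T D (fun t => θ t l)) (j : Fin N) :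
    IsOsc ε C T ((|M.α| + |M.α * M.β| * hi j ^ 2 + |M.κ j| / lo j * M.currentBound hi j)
        * (1 + 4 * D))
      (fun t => (M.field (ω * t) (r, θ t)).2 j - M.κ j * M.avgQ ω r (θ t) j / r j ^ 2) := by
  have hr0 : ∀ l, 0 < r l := fun l => (hlo l).trans_le (hr l).1
  have hra : ∀ l, |r l| ≤ hi l := fun l => by rw [abs_of_pos (hr0 l)]; exact (hr l).2
  have h1 := (isOsc_sin_mul_cos (hθ j) (hθ j) hε hω hD).const_mul (k := -M.α)
    (k' := |M.α|) (by rw [abs_neg])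
  have h2 := (isOsc_cos_pow_three_mul_sin (hθ j) hε hω hD).const_mul
    (k := M.α * M.β / 3 * r j ^ 2) (k' := |M.α * M.β| * hi j ^ 2) (by
      rw [abs_mul, abs_pow, abs_div, abs_of_pos (by norm_num : (0 : ℝ) < 3)]
      exact mul_le_mul (div_le_self (abs_nonneg _) (by norm_num))
        (pow_le_pow_left₀ (abs_nonneg _) (hra j) 2) (by positivity) (abs_nonneg _))
  have h3 := (M.isOsc_current hD hra hθ (w := fun t b => Real.sin (θ t j - b))
    (fun b hb => isOsc_sin_mul_cos (hθ j) hb hε hω hD) j).const_mul (k := M.κ j / r j)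
    (k' := |M.κ j| / lo j) (by
      rw [abs_div, abs_of_pos (hr0 j)]
      exact div_le_div_of_nonneg_left (abs_nonneg _) (hlo j) (hr j).1)
  rw [← mul_assoc] at h3
  have h := (h1.add h2).add h3
  rw [← add_mul, ← add_mul] at h
  refine h.congr fun t _ => ?_
  rw [M.avgQ_eq hω0]
  simp only [field, drive, g, sub_self, Real.sin_zero]
  have := (hr0 j).ne'
  field_simp
  ring

end Osc
end Microgrid

/-! ### The droop solution along the averaged dynamics -/

lemma freq_pos {L C : ℝ} (hL : 0 < L) (hC : 0 < C) : 0 < freq L C :=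
  one_div_pos.2 (Real.sqrt_pos.2 (mul_pos hL hC))

lemma eps_mul_freq {L C : ℝ} (hL : 0 < L) (hC : 0 < C) : eps L C * freq L C = 1 / C := by
  have h : √(L * C) = C * √(L / C) := by
    rw [show L * C = C ^ 2 * (L / C) by field_simp, Real.sqrt_mul (by positivity),
      Real.sqrt_sq hC.le]
  have : 0 < √(L / C) := Real.sqrt_pos.2 (div_pos hL hC)
  rw [eps, freq, h]
  field_simp

namespace Microgrid

/-- Under the voltage-droop law the averaged amplitude rate (times `C`) at a steady amplitude is
bounded by its distance to the equilibrium: the law fixes `κ P'` to be the linearization of the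
power balance at `r_eq`. -/
lemma abs_amplitudeRate_le {M : Microgrid N} (hα : 0 < M.α) (hβ : 0 < M.β) {j : Fin N}
    {P P' ρ d : ℝ} {req : Fin N → ℝ} (hr : M.IsAmplitudeEquilibrium j P (req j))
    (hκ : M.κ j ≠ 0) (hs : M.α * (req j - M.β / 2 * req j ^ 3) ≠ 0)
    (hρ : ρ ∈ Set.Icc (req j / 2) (2 * req j)) (hd : |ρ - req j| ≤ d)
    (hdroop : ρ - req j = M.voltDroop req j * (P - P')) :
    |M.α / 2 * (ρ - M.β / 4 * ρ ^ 3) - M.κ j * P' / ρ| ≤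
      d * ((M.α / 2 * (3 * req j + M.β / 4 * (15 * req j ^ 3))
        + |M.α * (req j - M.β / 2 * req j ^ 3)|) * (2 / req j)) := by
  obtain ⟨hr0, he⟩ := (M.isAmplitudeEquilibrium_iff j P _).1 hr
  obtain ⟨hρ1, hρ2⟩ := hρ
  set s := M.α * (req j - M.β / 2 * req j ^ 3) with hsdef
  have hρ0 : 0 < ρ := by linarith
  have hd0 : 0 ≤ d := (abs_nonneg _).trans hd
  have hP' : M.κ j * P' = M.κ j * P + s * (ρ - req j) := by
    rw [hdroop, voltDroop, ← hsdef]
    field_simp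
    ring
  have e : M.α / 2 * (ρ - M.β / 4 * ρ ^ 3) - M.κ j * P' / ρ
      = (ρ - req j) * ((M.α / 2 * ((ρ + req j) - M.β / 4 * ((ρ + req j) * (ρ ^ 2 + req j ^ 2)))
        - s) * (1 / ρ)) := by
    rw [hP', ← he]
    field_simp
    ring
  have h1 : ρ + req j ≤ 3 * req j := by linarith
  have h2 : ρ ^ 2 + req j ^ 2 ≤ 5 * req j ^ 2 := by nlinarith
  have h3 : (ρ + req j) * (ρ ^ 2 + req j ^ 2) ≤ 15 * req j ^ 3 := by
    calc (ρ + req j) * (ρ ^ 2 + req j ^ 2) ≤ (3 * req j) * (5 * req j ^ 2) :=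
          mul_le_mul h1 h2 (by positivity) (by positivity)
      _ = _ := by ring
  have h4 : |(ρ + req j) - M.β / 4 * ((ρ + req j) * (ρ ^ 2 + req j ^ 2))|
      ≤ 3 * req j + M.β / 4 * (15 * req j ^ 3) := by
    refine (abs_sub _ _).trans (add_le_add ?_ ?_)
    · rwa [abs_of_pos (by linarith)]
    · rw [abs_of_nonneg (by positivity)]
      exact mul_le_mul_of_nonneg_left h3 (by positivity)
  have h5 : 1 / ρ ≤ 2 / req j := by
    rw [div_le_div_iff₀ hρ0 hr0]
    linarith
  rw [e, abs_mul, abs_mul, abs_of_pos (one_div_pos.2 hρ0)]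
  refine mul_le_mul hd (mul_le_mul ((abs_sub _ _).trans (add_le_add ?_ le_rfl)) h5
    (by positivity) (by positivity)) (by positivity) hd0
  rw [abs_mul, abs_of_pos (by positivity : 0 < M.α / 2)]
  exact mul_le_mul_of_nonneg_left h4 (by positivity)

/-- The cost of evaluating the phase rate at the equilibrium amplitude `a`, as the frequency-droop
coefficient does, instead of the actual amplitude `ρ`. -/
lemma abs_phaseRate_sub_le {a q ρ d : ℝ} (ha : 0 < a) (hρ : ρ ∈ Set.Icc (a / 2) (2 * a))
    (hd : |ρ - a| ≤ d) : |q / ρ ^ 2 - q / a ^ 2| ≤ d * (12 * |q| / a ^ 3) := by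
  obtain ⟨hρ1, hρ2⟩ := hρ
  have hρ0 : 0 < ρ := by linarith
  have e : q / ρ ^ 2 - q / a ^ 2 = (ρ - a) * (-q * ((ρ + a) / (ρ ^ 2 * a ^ 2))) := by
    field_simp
    ring
  have h : (ρ + a) / (ρ ^ 2 * a ^ 2) ≤ 12 / a ^ 3 := by
    rw [div_le_div_iff₀ (by positivity) (by positivity)]
    have h2 : (a / 2) ^ 2 ≤ ρ ^ 2 := pow_le_pow_left₀ (by positivity) hρ1 2
    calc (ρ + a) * a ^ 3 ≤ (3 * a) * a ^ 3 :=
          mul_le_mul_of_nonneg_right (by linarith) (by positivity)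
      _ = 12 * ((a / 2) ^ 2 * a ^ 2) := by ring
      _ ≤ 12 * (ρ ^ 2 * a ^ 2) := by gcongr
  rw [e, abs_mul]
  refine mul_le_mul hd ?_ (abs_nonneg _) ((abs_nonneg _).trans hd)
  rw [abs_mul, abs_neg, abs_of_nonneg (by positivity : 0 ≤ (ρ + a) / (ρ ^ 2 * a ^ 2)),
    mul_comm (12 : ℝ), mul_div_assoc]
  exact mul_le_mul_of_nonneg_left h (abs_nonneg _)

/-- Droop trajectories with steady amplitudes near equilibrium follow the oscillator field up to
oscillations, with a constant uniform in `L`, `C ≥ C₀` and the trajectory. -/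
lemma exists_isOsc_droop_defect (M : Microgrid N) (hα : 0 < M.α) (hβ : 0 < M.β)
    {Peq req : Fin N → ℝ} (hreq : ∀ j, M.IsAmplitudeEquilibrium j (Peq j) (req j))
    (hκ : ∀ j, M.κ j ≠ 0) (hs : ∀ j, M.α * (req j - M.β / 2 * req j ^ 3) ≠ 0)
    {C₀ K₁ : ℝ} (hC₀ : 0 < C₀) (hK₁ : 0 ≤ K₁) :
    ∃ c, 0 ≤ c ∧ ∀ L C T : ℝ, 0 < L → C₀ ≤ C → 0 ≤ T → ∀ (ρ : Fin N → ℝ) (θ : ℝ → Fin N → ℝ),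
      (∀ j, ρ j ∈ Set.Icc (req j / 2) (2 * req j)) →
      (∀ j, |ρ j - req j| ≤ K₁ * eps L C) →
      M.IsDroopSolution (freq L C) (M.freqDroop C req) (M.voltDroop req) (fun _ => 0) Peq req T
        (fun _ => ρ) θ →
      ∀ j, IsOsc (eps L C) C T c (fun t => (M.field (freq L C * t) (ρ, θ t)).1 j) ∧
        IsOsc (eps L C) C T c (fun t => (M.field (freq L C * t) (ρ, θ t)).2 j
          - C * (M.freqDroop C req j * M.avgQ (freq L C) ρ (θ t) j)) := by
  have hr0 : ∀ j, 0 < req j := fun j => (hreq j).1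
  set lo : Fin N → ℝ := fun j => req j / 2 with hlo
  set hi : Fin N → ℝ := fun j => 2 * req j with hhi
  have hlo0 : ∀ j, 0 < lo j := fun j => half_pos (hr0 j)
  have hhi0 : ∀ j, 0 < hi j := fun j => mul_pos two_pos (hr0 j)
  have hcb : ∀ j, 0 ≤ M.currentBound hi j := M.currentBound_nonneg fun l => (hhi0 l).le
  set q : Fin N → ℝ := fun j => |M.κ j| * (hi j * M.currentBound hi j) with hq
  have hq0 : ∀ j, 0 ≤ q j := fun j =>
    mul_nonneg (abs_nonneg _) (mul_nonneg (hhi0 j).le (hcb j))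
  -- a bound of the droop frequencies
  set D := ∑ j, q j / (req j ^ 2 * C₀) with hD
  have hDt : ∀ j ∈ Finset.univ, 0 ≤ q j / (req j ^ 2 * C₀) := fun j _ =>
    div_nonneg (hq0 j) (by positivity)
  have hD0 : 0 ≤ D := Finset.sum_nonneg hDt
  set A : Fin N → ℝ := fun j =>
    (|M.α| * hi j + |M.α * M.β| * hi j ^ 3 + |M.κ j| * M.currentBound hi j) * (1 + 4 * D)
      + K₁ * ((M.α / 2 * (3 * req j + M.β / 4 * (15 * req j ^ 3))
        + |M.α * (req j - M.β / 2 * req j ^ 3)|) * (2 / req j)) / C₀ with hA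
  set B : Fin N → ℝ := fun j =>
    (|M.α| + |M.α * M.β| * hi j ^ 2 + |M.κ j| / lo j * M.currentBound hi j) * (1 + 4 * D)
      + K₁ * (12 * q j / req j ^ 3) / C₀ with hB
  have hAj : ∀ j, 0 ≤ A j := fun j => by
    have := hcb j; have := hr0 j; have := hhi0 j
    positivity
  have hBj : ∀ j, 0 ≤ B j := fun j => by
    have := hcb j; have := hr0 j; have := hhi0 j; have := hlo0 j; have := hq0 j
    positivity
  have hsum : ∀ j ∈ Finset.univ, 0 ≤ A j + B j := fun j _ => add_nonneg (hAj j) (hBj j)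
  refine ⟨∑ j, (A j + B j), Finset.sum_nonneg hsum, ?_⟩
  intro L C T hL hCC hT ρ θ hρ hρd hsol j
  have hC : 0 < C := hC₀.trans_le hCC
  have hε : 0 ≤ eps L C := Real.sqrt_nonneg _
  have hω0 := freq_pos hL hC
  have hω := eps_mul_freq hL hC
  have hρ0 : ∀ l, 0 < ρ l := fun l => (hlo0 l).trans_le (hρ l).1
  have hρa : ∀ l, |ρ l| ≤ hi l := fun l => by rw [abs_of_pos (hρ0 l)]; exact (hρ l).2
  have hQ : ∀ t l, |M.κ l * M.avgQ (freq L C) ρ (θ t) l| ≤ q l := fun t l => by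
    rw [abs_mul]
    exact mul_le_mul_of_nonneg_left (M.abs_avgQ_le hω0 hρa l) (abs_nonneg _)
  have hle : A j + B j ≤ ∑ j, (A j + B j) := Finset.single_le_sum hsum (Finset.mem_univ j)
  have hslow : ∀ l, SlowOn T D (fun t => θ t l) := fun l =>
    ⟨_, fun t ht => ⟨hsol.phase_eq t ht l, by
      refine le_trans ?_ (Finset.single_le_sum hDt (Finset.mem_univ l))
      rw [sub_zero, freqDroop, div_mul_eq_mul_div, abs_div,
        abs_of_pos (mul_pos (pow_pos (hr0 l) 2) hC)]
      have := hr0 l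
      exact div_le_div₀ (hq0 l) (hQ t l) (by positivity)
        (mul_le_mul_of_nonneg_left hCC (by positivity))⟩⟩
  -- division by `C` instead of `C₀` only improves the residuals
  have hres : ∀ {x S : ℝ}, |x| ≤ K₁ * eps L C * S → |x / C| ≤ K₁ * S / C₀ * eps L C := by
    intro x S hx
    have h0 := (abs_nonneg x).trans hx
    rw [abs_div, abs_of_pos hC]
    calc |x| / C ≤ (K₁ * eps L C * S) / C₀ := div_le_div₀ h0 hx hC₀ hCC
      _ = _ := by ring
  constructor
  · refine IsOsc.mono hε (IsOsc.of_close (M.isOsc_field_fst hε hω hω0 hD0 hlo0 hρ hslow j)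
      ?_ fun t ht => ?_) ((le_add_of_nonneg_right (hBj j)).trans hle)
    · have := hr0 j
      positivity
    · rw [← sub_div, abs_div, sub_sub_cancel_left, abs_neg, ← abs_div]
      exact hres (abs_amplitudeRate_le hα hβ (hreq j) (hκ j) (hs j) (hρ j) (hρd j)
        (hsol.amplitude_eq t ht j))
  · refine IsOsc.mono hε (IsOsc.of_close (M.isOsc_field_snd hε hω hω0 hD0 hlo0 hρ hslow j)
      ?_ fun t ht => ?_) ((le_add_of_nonneg_left (hAj j)).trans hle)
    · have := hr0 j; have := hq0 j
      positivity
    · have e : C * (M.freqDroop C req j * M.avgQ (freq L C) ρ (θ t) j)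
          = M.κ j * M.avgQ (freq L C) ρ (θ t) j / req j ^ 2 := by
        have := hr0 j
        rw [freqDroop]
        field_simp
      rw [← sub_div, e, sub_sub_sub_cancel_left, abs_div, abs_sub_comm, ← abs_div]
      refine hres ((abs_phaseRate_sub_le (hr0 j) (hρ j) (hρd j)).trans ?_)
      have := hr0 j
      have := hQ t j
      have : 0 ≤ K₁ * eps L C := mul_nonneg hK₁ hε
      gcongr

/-- Some oscillator solution stays `O(ε)`-close to a droop solution whose amplitudes are constantly
`ρ`. -/
lemma exists_voc_close_to_droop (M : Microgrid N) (hα : 0 < M.α) (hβ : 0 < M.β)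
    {Peq req : Fin N → ℝ} (hreq : ∀ j, M.IsAmplitudeEquilibrium j (Peq j) (req j))
    (hκ : ∀ j, M.κ j ≠ 0) (hs : ∀ j, M.α * (req j - M.β / 2 * req j ^ 3) ≠ 0)
    {T C₀ K₀ : ℝ} (hT : 0 ≤ T) (hC₀ : 0 < C₀) (hK₀ : 0 ≤ K₀) :
    ∃ εstar : ℝ, 0 < εstar ∧ ∃ K : ℝ, 0 ≤ K ∧ ∀ L C : ℝ, 0 < L → C₀ ≤ C → eps L C < εstar →
      ∀ (ρ : Fin N → ℝ) (θ : ℝ → Fin N → ℝ),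
      M.IsDroopSolution (freq L C) (M.freqDroop C req) (M.voltDroop req) (fun _ => 0) Peq req T
        (fun _ => ρ) θ →
      ∀ x₀ : State N, (∀ j, |ρ j - req j| ≤ 2 * K₀ * eps L C) →
        dist x₀ (ρ, θ 0) ≤ K₀ * eps L C →
        ∃ x : ℝ → State N, x 0 = x₀ ∧
          M.IsVOCSolution L C T (fun t => (x t).1) (fun t => (x t).2) ∧
          ∀ t ∈ Set.Icc 0 T, dist (x t) (ρ, θ t) ≤ K * eps L C := by
  have hr0 : ∀ j, 0 < req j := fun j => (hreq j).1
  obtain ⟨c, hc0, hc⟩ := M.exists_isOsc_droop_defect hα hβ hreq hκ hs hC₀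
    (mul_nonneg zero_le_two hK₀)
  have hlo : ∀ j, 0 < req j / 2 := fun j => half_pos (hr0 j)
  have hlh : ∀ j, req j / 2 ≤ 2 * req j := fun j => by linarith [hr0 j]
  obtain ⟨Λ, hΛ1, hΛ⟩ := M.exists_clampedField_bound hlo hlh
  set k := Λ / C₀ with hk
  have hk0 : 0 < k := by positivity
  set K := (K₀ + c + (c + k * c) / k) * Real.exp (k * T) + c with hK
  have hKpos : 0 ≤ K := by positivity
  obtain ⟨δ, hδ0, hδ⟩ : ∃ δ : ℝ, 0 < δ ∧ ∀ j, δ ≤ req j / 2 := by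
    have h : ∀ᶠ δ : ℝ in nhdsWithin 0 (Set.Ioi 0), 0 < δ ∧ ∀ j, δ ≤ req j / 2 :=
      (eventually_mem_nhdsWithin).and (Filter.eventually_all.2 fun j =>
        nhdsWithin_le_nhds (Iic_mem_nhds (hlo j)))
    exact h.exists
  refine ⟨δ / (K + 2 * K₀ + 1), by positivity, K, hKpos, ?_⟩
  intro L C hL hCC hεlt ρ θ hsol x₀ hρd hx₀
  have hC : 0 < C := hC₀.trans_le hCC
  have hε : 0 ≤ eps L C := Real.sqrt_nonneg _
  have hεδ : (K + 2 * K₀ + 1) * eps L C ≤ δ := by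
    rw [lt_div_iff₀ (by positivity)] at hεlt
    linarith
  have hKε : 0 ≤ K * eps L C := mul_nonneg hKpos hε
  have hK₀ε : 0 ≤ K₀ * eps L C := mul_nonneg hK₀ hε
  have hnear : ∀ {z : ℝ} (j), |z - req j| ≤ δ → z ∈ Set.Icc (req j / 2) (2 * req j) := by
    intro z j hz
    have := abs_le.1 hz
    have := hδ j
    constructor <;> linarith [hr0 j]
  have hρ : ∀ j, ρ j ∈ Set.Icc (req j / 2) (2 * req j) := fun j =>
    hnear j ((hρd j).trans (by linarith))
  obtain ⟨x, hx0, hx⟩ := M.exists_clamped_solution hlo hlh hC hT (freq L C) x₀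
  have hosc := hc L C T hL hCC hT ρ θ hρ hρd hsol
  have hclose : ∀ t ∈ Set.Icc 0 T, dist (x t) (ρ, θ t) ≤ K * eps L C := by
    refine M.dist_clamped_solution_le (k := K₀) (y := fun t => (ρ, θ t))
      (y' := fun t => (0, fun j => M.freqDroop C req j * M.avgQ (freq L C) ρ (θ t) j))
      hε hC hc0 hK₀ hk0 (hΛ C₀ C (freq L C) hC₀ hCC).2 hx (fun t ht => ?_) (fun t _ => hρ)
      (fun j => ?_) (fun j => (hosc j).2) (by rwa [hx0])
    · refine (hasDerivWithinAt_const _ _ _).prodMk (hasDerivWithinAt_pi.2 fun j => ?_)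
      simpa using hsol.phase_eq t ht j
    · simpa using (hosc j).1
  have hbox : ∀ t ∈ Set.Icc 0 T, x t ∈ amplitudeBox (fun j => req j / 2) fun j => 2 * req j := by
    intro t ht j
    refine hnear j ?_
    have h1 := (abs_fst_sub_le (x t) (ρ, θ t) j).trans (hclose t ht)
    have h2 := abs_sub_le ((x t).1 j) (ρ j) (req j)
    have h3 := hρd j
    simp only at h1
    linarith
  refine ⟨x, hx0, isVOCSolution_of_hasDerivWithinAt
    (fun t ht j => (hlo j).trans_le (hbox t ht j).1) fun t ht => ?_, hclose⟩
  have h := hx t ht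
  rwa [clampedField, clamp_of_mem (hbox t ht)] at h

end Microgrid

end DroopVOC

end

theorem theorem1 {N : ℕ} (M : DroopVOC.Microgrid N) (hα : 0 < M.α) (hβ : 0 < M.β)
    (Peq : Fin N → ℝ)
    (hP : ∀ j, 0 < M.κ j * Peq j ∧ M.κ j * Peq j < M.α / (2 * M.β)) :
    (∀ j, ∃ ρ : ℝ, M.IsAmplitudeEquilibrium j (Peq j) ρ) ∧
    ∀ req : Fin N → ℝ, (∀ j, M.IsAmplitudeEquilibrium j (Peq j) (req j)) →
      (∀ j, M.α * (req j - M.β / 2 * req j ^ 3) ≠ 0) ∧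
      ∀ tstar : ℝ, 0 < tstar → ∀ C₀ : ℝ, 0 < C₀ → ∀ K₀ : ℝ, 0 ≤ K₀ →
        ∃ εstar : ℝ, 0 < εstar ∧ ∃ K : ℝ, 0 ≤ K ∧
          ∀ L C : ℝ, 0 < L → C₀ ≤ C → DroopVOC.eps L C < εstar →
          -- a solution of the droop-controlled microgrid whose amplitudes are in steady state
          ∀ rbar θbar : ℝ → Fin N → ℝ,
            M.IsDroopSolution (DroopVOC.freq L C) (M.freqDroop C req) (M.voltDroop req)
              (fun _ => 0) Peq req tstar rbar θbar →
            (∀ t ∈ Set.Icc 0 tstar, ∀ j, rbar t j = rbar 0 j) →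
          -- initial data of the oscillator-controlled microgrid
          ∀ r₀ θ₀ : Fin N → ℝ,
            (∀ j, |r₀ j - req j| ≤ K₀ * DroopVOC.eps L C) →
            (∀ j, |rbar 0 j - r₀ j| ≤ K₀ * DroopVOC.eps L C) →
            (∀ j, |θbar 0 j - θ₀ j| ≤ K₀ * DroopVOC.eps L C) →
            (∃ r θ : ℝ → Fin N → ℝ, M.IsVOCSolution L C tstar r θ ∧ r 0 = r₀ ∧ θ 0 = θ₀) ∧
            ∀ r θ : ℝ → Fin N → ℝ, M.IsVOCSolution L C tstar r θ → r 0 = r₀ → θ 0 = θ₀ →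
              ∀ t ∈ Set.Icc 0 tstar, ∀ j,
                |rbar t j - r t j| ≤ K * DroopVOC.eps L C ∧
                |θbar t j - θ t j| ≤ K * DroopVOC.eps L C := by
  refine ⟨fun j => M.exists_isAmplitudeEquilibrium hα hβ (hP j).2, fun req hreq => ?_⟩
  have hs := fun j => (hreq j).slope_ne_zero hα hβ (hP j).2
  have hκ : ∀ j, M.κ j ≠ 0 := fun j => left_ne_zero_of_mul (hP j).1.ne'
  refine ⟨hs, fun tstar hT C₀ hC₀ K₀ hK₀ => ?_⟩
  obtain ⟨εstar, hεstar, K, hK, H⟩ :=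
    M.exists_voc_close_to_droop hα hβ hreq hκ hs hT.le hC₀ hK₀
  refine ⟨εstar, hεstar, K, hK, fun L C hL hCC hε rbar θbar hsol hconst r₀ θ₀ h1 h2 h3 => ?_⟩
  have hr : ∀ t ∈ Set.Icc 0 tstar, rbar t = rbar 0 := fun t ht => funext (hconst t ht)
  have hsol' : M.IsDroopSolution (DroopVOC.freq L C) (M.freqDroop C req) (M.voltDroop req)
      (fun _ => 0) Peq req tstar (fun _ => rbar 0) θbar :=
    ⟨fun t ht j => by simpa only [hr t ht] using hsol.phase_eq t ht j,
      fun t ht j => by simpa only [hr t ht] using hsol.amplitude_eq t ht j⟩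
  obtain ⟨x, hx0, hx, hclose⟩ := H L C hL hCC hε (rbar 0) θbar hsol' (r₀, θ₀)
    (fun j => (abs_sub_le _ (r₀ j) _).trans (by linarith [h1 j, h2 j]))
    (by
      rw [dist_comm]
      exact DroopVOC.dist_le_of_coord (mul_nonneg hK₀ (Real.sqrt_nonneg _)) h2 h3)
  refine ⟨⟨_, _, hx, by simp [hx0], by simp [hx0]⟩, fun r θ hvoc hr0 hθ0 t ht j => ?_⟩
  have heq : (r t, θ t) = x t :=
    hvoc.eqOn (hC₀.trans_le hCC) hT.le hx (by simp [hx0, hr0]) (by simp [hx0, hθ0]) ht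
  have hd := hclose t ht
  rw [dist_comm, ← heq] at hd
  rw [hr t ht]
  exact ⟨(DroopVOC.abs_fst_sub_le _ _ j).trans hd, (DroopVOC.abs_snd_sub_le _ _ j).trans hd⟩
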